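/- For real $\alpha\ge 0$ let $\zeta_1(s,\alpha)=\sum_{n\ge 1}(n+\alpha)^{-s}$ for $\operatorname{Re} s>1$, continued analytically to $s\in\mathbb{C}\setminus\{1\}$, let $\zeta$ be the Riemann zeta function, and for integers $k\ge 1$ and real $t>0$ let $$I_k(t)=\int_0^1\bigl|\zeta_1(\tfrac12+it,\alpha)\bigr|^{2k}\,d\alpha .$$ Then there are absolute constants $C>0$ and $T>0$, in particular independent of $k$, such that $$\bigl|\zeta(\tfrac12+it)\bigr|\le C\,t^{1/(4k)}\,I_k(t)^{1/(2k)}\qquad\text{for all } t\ge T \text{ and all integers } k\ge 1 .$$ Consequently, if for every $\varepsilon>0$ and every integer $k\ge 1$ one has $I_k(t)=O_{k,\varepsilon}(t^{\varepsilon})$ as $t\to\infty$, then the Lindelöf hypothesis holds, that is, $\zeta(\tfrac12+it)=O_{\varepsilon}(t^{\varepsilon})$ as $t\to\infty$ for every $\varepsilon>0$. -/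

import Mathlib

open Complex Filter Asymptotics

/-- The modified Hurwitz zeta function `ζ₁(s, α) = ∑_{n ≥ 1} (n + α)^{-s}` for real `α ≥ 0`,
continued analytically to `s ≠ 1`. It is Mathlib's Hurwitz zeta function, which depends only on the
class of `α` modulo `1`, with the finitely many terms `α^{-s}, (α - 1)^{-s}, …` of positive base
removed. For `0 < α ≤ 1` only the term `α^{-s}` is removed, and for `α = 0` none is. -/
noncomputable def modifiedHurwitzZeta (s : ℂ) (α : ℝ) : ℂ :=
  HurwitzZeta.hurwitzZeta (α : UnitAddCircle) s
    - ∑ m ∈ Finset.range ⌈α⌉₊, 1 / ((α : ℂ) - (m : ℂ)) ^ s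

/-- In the half plane `Re s > 1` the function is given by its defining series. -/
theorem hasSum_modifiedHurwitzZeta {α : ℝ} (hα : 0 ≤ α) {s : ℂ} (hs : 1 < s.re) :
    HasSum (fun n : ℕ => 1 / (((n + 1 : ℕ) : ℂ) + (α : ℂ)) ^ s) (modifiedHurwitzZeta s α) := by
  have hs0 : s ≠ 0 := by
    rintro rfl
    norm_num at hs
  rcases hα.eq_or_lt with rfl | hpos
  · have h := HurwitzZeta.hasSum_hurwitzZeta_of_one_lt_re (a := 0) (by simp) hs
    have h' := (hasSum_nat_add_iff' 1).mpr h
    simpa [modifiedHurwitzZeta, hs0, Complex.zero_cpow] using h'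
  · set c := ⌈α⌉₊ with hc
    have h1 : α ≤ c := Nat.le_ceil α
    have h2 : (c : ℝ) < α + 1 := Nat.ceil_lt_add_one hα
    have h := HurwitzZeta.hasSum_hurwitzZeta_of_one_lt_re (a := α - c + 1)
      ⟨by linarith, by linarith⟩ hs
    have hcirc : ((α - c + 1 : ℝ) : UnitAddCircle) = (α : UnitAddCircle) := by
      have e : (α - c + 1 : ℝ) = α + (((1 - c : ℤ)) : ℝ) * 1 := by
        push_cast
        ring
      have z : (((((1 - c : ℤ)) : ℝ) * 1 : ℝ) : UnitAddCircle) = 0 := by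
        rw [AddCircle.coe_eq_zero_iff]
        exact ⟨1 - c, by simp⟩
      rw [e, AddCircle.coe_add, z, add_zero]
    rw [hcirc] at h
    have h' := (hasSum_nat_add_iff' c).mpr h
    have hsum : ∑ m ∈ Finset.range c, 1 / ((α : ℂ) - (m : ℂ)) ^ s
        = ∑ i ∈ Finset.range c, 1 / ((i : ℂ) + ((α - c + 1 : ℝ) : ℂ)) ^ s := by
      rw [← Finset.sum_range_reflect]
      refine Finset.sum_congr rfl fun j hj => ?_
      have hj' : j + 1 ≤ c := Finset.mem_range.mp hj
      have e : ((c - 1 - j : ℕ) : ℂ) = (c : ℂ) - 1 - j := by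
        rw [Nat.sub_sub, Nat.cast_sub (by omega)]
        push_cast
        ring
      rw [e]
      push_cast
      congr 2
      ring
    rw [modifiedHurwitzZeta, ← hc, hsum]
    have hfun : (fun n : ℕ => 1 / (((n + 1 : ℕ) : ℂ) + (α : ℂ)) ^ s)
        = fun n : ℕ => 1 / (((n + c : ℕ) : ℂ) + ((α - c + 1 : ℝ) : ℂ)) ^ s := by
      funext n
      have e : ((n + 1 : ℕ) : ℂ) + (α : ℂ) = ((n + c : ℕ) : ℂ) + ((α - c + 1 : ℝ) : ℂ) := by
        push_cast
        ring
      rw [e]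
    rw [hfun]
    exact h'

/-- The function is holomorphic in `s` away from `s = 1`. -/
theorem differentiableAt_modifiedHurwitzZeta {α : ℝ} {s : ℂ} (hs : s ≠ 1) :
    DifferentiableAt ℂ (fun z => modifiedHurwitzZeta z α) s := by
  unfold modifiedHurwitzZeta
  refine (HurwitzZeta.differentiableAt_hurwitzZeta _ hs).sub ?_
  refine DifferentiableAt.fun_sum fun m hm => ?_
  have hm' : (m : ℝ) < α := Nat.lt_ceil.mp (Finset.mem_range.mp hm)
  have hne : (α : ℂ) - (m : ℂ) ≠ 0 := by
    rw [sub_ne_zero]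
    exact_mod_cast hm'.ne'
  refine (differentiableAt_const _).div (differentiableAt_id.const_cpow (Or.inl hne)) ?_
  simp [Complex.cpow_eq_zero_iff, hne]

/-- The `2k`-th power mean `I_k(t) = ∫₀¹ |ζ₁(1/2 + it, α)|^{2k} dα`. -/
noncomputable def hurwitzPowerMean (k : ℕ) (t : ℝ) : ℝ :=
  ∫ α in (0 : ℝ)..1, ‖modifiedHurwitzZeta (1 / 2 + (t : ℂ) * I) α‖ ^ (2 * k)

/-- The Lindelöf hypothesis: `ζ(1/2 + it) = O(t^ε)` as `t → ∞`, for every `ε > 0`. -/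
def LindelofHypothesis : Prop :=
  ∀ ε : ℝ, 0 < ε →
    (fun t : ℝ => riemannZeta (1 / 2 + (t : ℂ) * I)) =O[atTop] (fun t : ℝ => t ^ ε)

/-! The plan is to recover `ζ(s)`, `s = 1/2 + it`, from a local average of `ζ₁(s, ·)` near the
integers, and then to pass from the average to the power mean by Jensen. The weight is `K =
expKernel c`, nonnegative, of mass one on the circle, at most `c` and of width `1/c`, with `c ^ 2 =
2πt`. Since `K ≤ c` and `c` is of order `t ^ (1/2)`, the average is at most `(c I_k) ^ (1/(2k))`,
which is where `t ^ (1/(4k))` comes from.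

Why the average sees `ζ(s)`: `K` is Green's function of `1 - c⁻² d²/dx²` on the circle. Near `x` the
function `x ^ (-s)` oscillates with frequency `t / x`, so the resolvent multiplies it by about `x ^
2 / (Y + x ^ 2)` with `Y = (t / c) ^ 2`. Green's formula on the unit intervals of `[1, N + 1]` then
gives `∫ K ζ₁ = ∑ n ^ (-s) n ^ 2 / (Y + n ^ 2) + O(1)` in the regularized sense, which is `ζ(s) -
smoothedZeta c s + O(1)` (`norm_integral_expKernel_mul_sub_le`).

Why the smoothed sum is harmless: for `c ^ 2 = 2πt` one has `Y = (c / 2π) ^ 2`, so its weights `Y /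
(Y + n ^ 2)` are exactly the Fourier coefficients of `K`. The `n`-th cosine coefficient of `ζ₁(s, α)
+ α ^ (-s)` is `χ(s) n ^ (s - 1)`, and on the critical line `|χ| = 1` and `n ^ (s - 1)` is conjugate
to `n ^ (-s)`. Parseval therefore turns `|smoothedZeta|` into the modulus of the same average of
`ζ₁`, up to `O(1)` (`norm_smoothedZeta_eq`). Hence `|ζ(s)| ≤ 2 |∫ K ζ₁| + O(1)`
(`norm_riemannZeta_le`).

The `O(1)` is absorbed because `I_k ^ (1/(2k))` is bounded below: the first cosine coefficient of
`ζ₁` has modulus `1 + O(1/t)` (`one_le_four_mul_rpow_hurwitzPowerMean`). -/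

/-! ### Euler–Maclaurin continuation of `ζ₁(s, α)`, uniform in `α`. -/

theorem norm_ofReal_cpow_neg_sub_le {s : ℂ} (hs0 : s ≠ 0) (hs : 0 ≤ s.re) {a x y : ℝ} (ha : 0 < a)
    (hx : a ≤ x) (hy : a ≤ y) :
    ‖(y : ℂ) ^ (-s) - (x : ℂ) ^ (-s)‖ ≤ ‖s‖ * a ^ (-s.re - 1) * |y - x| := by
  have := Convex.norm_image_sub_le_of_norm_hasDerivWithin_le (𝕜 := ℝ) (s := Set.Ici a)
    (f := fun y : ℝ => (y : ℂ) ^ (-s)) (f' := fun y : ℝ => -s * (y : ℂ) ^ (-s - 1))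
    (C := ‖s‖ * a ^ (-s.re - 1))
    (fun z hz => (hasDerivAt_ofReal_cpow_const (ha.trans_le hz).ne'
      (neg_ne_zero.mpr hs0)).hasDerivWithinAt)
    (fun z hz => ?_) (convex_Ici a) hx hy
  · simpa using this
  · rw [norm_mul, norm_neg, norm_cpow_eq_rpow_re_of_pos (ha.trans_le hz)]
    gcongr
    simp only [sub_re, neg_re, one_re]
    exact Real.rpow_le_rpow_of_nonpos ha hz (by linarith)

/-- The difference between the `n`-th term of the series of `ζ₁(s, α)` and the integral of `x ^ (-s)`
over `[n + 1, n + 2]`. -/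
noncomputable def hurwitzDefect (s : ℂ) (α : ℝ) (n : ℕ) : ℂ :=
  ((n + 1 + α : ℝ) : ℂ) ^ (-s)
    - (((n + 2 : ℝ) : ℂ) ^ (1 - s) - ((n + 1 : ℝ) : ℂ) ^ (1 - s)) / (1 - s)

/-- The defect is the integral of `(n + 1 + α) ^ (-s) - x ^ (-s)` over `[n + 1, n + 2]`, and `n + 1
+ α` lies in that interval, so the mean value bound applies. Uniformity in `α` is what later allows
summation and integration in `α` to be exchanged. -/
theorem norm_hurwitzDefect_le {s : ℂ} (hs1 : s ≠ 1) (hs : 0 < s.re) {α : ℝ}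
    (hα : α ∈ Set.Icc (0 : ℝ) 1) (n : ℕ) :
    ‖hurwitzDefect s α n‖ ≤ ‖s‖ * (n + 1 : ℝ) ^ (-s.re - 1) := by
  have hs0 : s ≠ 0 := by rintro rfl; simp at hs
  have hn : (0 : ℝ) < n + 1 := by positivity
  have h0 : (0 : ℝ) ∉ Set.uIcc (n + 1 : ℝ) (n + 2) := by
    rw [Set.uIcc_of_le (by linarith)]
    exact fun h => by linarith [h.1]
  have hint : IntervalIntegrable (fun x : ℝ => (x : ℂ) ^ (-s)) MeasureTheory.volume
      (n + 1 : ℝ) (n + 2) := intervalIntegral.intervalIntegrable_cpow (Or.inr h0)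
  have e : hurwitzDefect s α n
      = ∫ x in (n + 1 : ℝ)..(n + 2), (((n + 1 + α : ℝ) : ℂ) ^ (-s) - (x : ℂ) ^ (-s)) := by
    rw [intervalIntegral.integral_sub (by simp) hint, intervalIntegral.integral_const,
      integral_cpow (Or.inr ⟨by simpa using hs1, h0⟩), hurwitzDefect]
    have : (n + 2 - (n + 1) : ℝ) = 1 := by ring
    rw [this, one_smul, show -s + 1 = 1 - s by ring]
  rw [e]
  have := intervalIntegral.norm_integral_le_of_norm_le_const
    (f := fun x : ℝ => (((n + 1 + α : ℝ) : ℂ) ^ (-s) - (x : ℂ) ^ (-s)))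
    (a := (n + 1 : ℝ)) (b := n + 2) (C := ‖s‖ * (n + 1 : ℝ) ^ (-s.re - 1)) (fun x hx => ?_)
  · refine this.trans_eq ?_
    rw [show (n + 2 - (n + 1) : ℝ) = 1 by ring]
    simp
  · rw [Set.uIoc_of_le (by linarith)] at hx
    refine (norm_ofReal_cpow_neg_sub_le hs0 hs.le hn hx.1.le (by linarith [hα.1])).trans ?_
    refine mul_le_of_le_one_right (by positivity) ?_
    rw [abs_le]
    constructor <;> linarith [hα.1, hα.2, hx.1, hx.2]

theorem summable_nat_add_one_rpow {σ : ℝ} (hσ : 0 < σ) :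
    Summable fun n : ℕ => (n + 1 : ℝ) ^ (-σ - 1) := by
  have := (summable_nat_add_iff 1).mpr (Real.summable_nat_rpow.mpr (show -σ - 1 < -1 by linarith))
  simpa using this

theorem sum_hurwitzDefect (s : ℂ) (α : ℝ) (N : ℕ) :
    ∑ n ∈ Finset.range N, hurwitzDefect s α n
      = ∑ n ∈ Finset.range N, ((n + 1 + α : ℝ) : ℂ) ^ (-s)
        - (((N + 1 : ℝ) : ℂ) ^ (1 - s) - 1) / (1 - s) := by
  induction N with
  | zero => simp
  | succ N ih =>
    rw [Finset.sum_range_succ, ih, Finset.sum_range_succ, hurwitzDefect]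
    push_cast
    rw [show (N : ℂ) + 1 + 1 = N + 2 by ring]
    ring

theorem tendsto_nat_add_one_cpow {r : ℂ} (hr : r.re < 0) :
    Tendsto (fun N : ℕ => ((N + 1 : ℝ) : ℂ) ^ r) atTop (nhds 0) := by
  rw [tendsto_zero_iff_norm_tendsto_zero]
  have h : Tendsto (fun N : ℕ => (N + 1 : ℝ) ^ r.re) atTop (nhds 0) := by
    have := (tendsto_rpow_neg_atTop (y := -r.re) (by linarith)).comp
      (tendsto_atTop_add_const_right atTop (1 : ℝ) tendsto_natCast_atTop_atTop)
    simpa [Function.comp_def] using this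
  refine h.congr fun N => ?_
  rw [norm_cpow_eq_rpow_re_of_pos (by positivity)]

theorem modifiedHurwitzZeta_eq_tsum_of_one_lt_re {s : ℂ} (hs : 1 < s.re) {α : ℝ}
    (hα : α ∈ Set.Icc (0 : ℝ) 1) :
    modifiedHurwitzZeta s α = 1 / (s - 1) + ∑' n, hurwitzDefect s α n := by
  have hs1 : s ≠ 1 := by rintro rfl; simp at hs
  have h1 : HasSum (fun n => hurwitzDefect s α n) (∑' n, hurwitzDefect s α n) :=
    (Summable.of_norm_bounded ((summable_nat_add_one_rpow (by linarith)).mul_left ‖s‖)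
      (norm_hurwitzDefect_le hs1 (by linarith) hα)).hasSum
  have h2 := (hasSum_modifiedHurwitzZeta hα.1 hs).tendsto_sum_nat
  have h3 : Tendsto (fun N : ℕ => ∑ n ∈ Finset.range N, hurwitzDefect s α n) atTop
      (nhds (modifiedHurwitzZeta s α - (0 - 1) / (1 - s))) := by
    simp_rw [sum_hurwitzDefect]
    refine Tendsto.sub ?_ (((tendsto_nat_add_one_cpow (by simpa using hs)).sub_const 1).div_const _)
    refine h2.congr fun N => Finset.sum_congr rfl fun n _ => ?_
    rw [cpow_neg, one_div]
    push_cast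
    rfl
  rw [tendsto_nhds_unique h1.tendsto_sum_nat h3]
  have : s - 1 ≠ 0 := sub_ne_zero.mpr hs1
  have : 1 - s ≠ 0 := sub_ne_zero.mpr hs1.symm
  field_simp
  ring

/-- Euler–Maclaurin summation continues `ζ₁(s, α)` to the quarter plane `Re s > 0`, `Im s > 0`. -/
theorem modifiedHurwitzZeta_eq_tsum {s : ℂ} (hs : 0 < s.re) (hs' : 0 < s.im) {α : ℝ}
    (hα : α ∈ Set.Icc (0 : ℝ) 1) :
    modifiedHurwitzZeta s α = 1 / (s - 1) + ∑' n, hurwitzDefect s α n := by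
  -- A convex region that avoids the pole and contains both `s` and the point `w = s + 2` of
  -- absolute convergence; the ball keeps `‖z‖` bounded, so that one summable majorant serves the
  -- whole region.
  set U : Set ℂ := {z : ℂ | s.re / 2 < z.re} ∩ {z : ℂ | 0 < z.im} ∩ Metric.ball 0 (‖s‖ + 3) with hU
  have hUo : IsOpen U := ((isOpen_lt continuous_const continuous_re).inter
    (isOpen_lt continuous_const continuous_im)).inter Metric.isOpen_ball
  have hUc : IsPreconnected U := (((convex_halfSpace_re_gt _).inter
    (convex_halfSpace_im_gt _)).inter (convex_ball _ _)).isPreconnected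
  have hne : ∀ z ∈ U, z ≠ 1 := by
    rintro z hz rfl
    simpa using hz.1.2
  have hsU : s ∈ U := ⟨⟨show s.re / 2 < s.re by linarith, hs'⟩, by simp⟩
  set w : ℂ := ⟨s.re + 2, s.im⟩ with hw
  have hws : w = s + 2 := by apply Complex.ext <;> simp [hw]
  have hwU : w ∈ U := by
    refine ⟨⟨show s.re / 2 < s.re + 2 by linarith, hs'⟩, ?_⟩
    rw [mem_ball_zero_iff, hws]
    refine (norm_add_le _ _).trans_lt ?_
    norm_num
  have hf : DifferentiableOn ℂ (fun z => modifiedHurwitzZeta z α) U := fun z hz =>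
    (differentiableAt_modifiedHurwitzZeta (hne z hz)).differentiableWithinAt
  have hg : DifferentiableOn ℂ (fun z => 1 / (z - 1) + ∑' n, hurwitzDefect z α n) U := by
    refine DifferentiableOn.add ?_ ?_
    · exact (differentiableOn_const _).div (by fun_prop) fun z hz => sub_ne_zero.mpr (hne z hz)
    · refine differentiableOn_tsum_of_summable_norm
        (u := fun n : ℕ => (‖s‖ + 3) * (n + 1 : ℝ) ^ (-(s.re / 2) - 1))
        ((summable_nat_add_one_rpow (by linarith)).mul_left _) (fun n => ?_) hUo
        (fun n z hz => ?_)
      · unfold hurwitzDefect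
        intro z hz
        have h1 : 1 - z ≠ 0 := sub_ne_zero.mpr (hne z hz).symm
        have a1 : ((n + 1 + α : ℝ) : ℂ) ≠ 0 := by
          have := hα.1
          exact_mod_cast (by positivity : (0 : ℝ) < n + 1 + α).ne'
        have a2 : ((n + 2 : ℝ) : ℂ) ≠ 0 := by
          exact_mod_cast (by positivity : (0 : ℝ) < n + 2).ne'
        have a3 : ((n + 1 : ℝ) : ℂ) ≠ 0 := by
          exact_mod_cast (by positivity : (0 : ℝ) < n + 1).ne'
        refine DifferentiableAt.differentiableWithinAt ?_
        refine DifferentiableAt.sub ?_ (DifferentiableAt.div ?_ (by fun_prop) h1)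
        · exact DifferentiableAt.const_cpow (by fun_prop) (Or.inl a1)
        · exact (DifferentiableAt.const_cpow (by fun_prop) (Or.inl a2)).sub
            (DifferentiableAt.const_cpow (by fun_prop) (Or.inl a3))
      · have hz1 : s.re / 2 < z.re := hz.1.1
        refine (norm_hurwitzDefect_le (hne z hz) (by linarith) hα n).trans ?_
        have := hz.2
        rw [mem_ball_zero_iff] at this
        gcongr
        linarith
  refine (hf.analyticOnNhd hUo).eqOn_of_preconnected_of_eventuallyEq (hg.analyticOnNhd hUo) hUc
    hwU ?_ hsU
  have : {z : ℂ | 1 < z.re} ∈ nhds w :=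
    (isOpen_lt continuous_const continuous_re).mem_nhds (show (1 : ℝ) < s.re + 2 by linarith)
  filter_upwards [this] with z hz using modifiedHurwitzZeta_eq_tsum_of_one_lt_re hz hα

theorem continuousOn_hurwitzDefect (s : ℂ) (n : ℕ) :
    ContinuousOn (fun α => hurwitzDefect s α n) (Set.Icc 0 1) := by
  unfold hurwitzDefect
  refine ContinuousOn.sub ?_ continuousOn_const
  refine ContinuousOn.cpow_const (by fun_prop) fun α hα => ?_
  rw [ofReal_mem_slitPlane]
  have := hα.1
  positivity

theorem continuousOn_modifiedHurwitzZeta {s : ℂ} (hs : 0 < s.re) (hs' : 0 < s.im) :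
    ContinuousOn (fun α => modifiedHurwitzZeta s α) (Set.Icc 0 1) := by
  have hs1 : s ≠ 1 := by rintro rfl; simp at hs'
  refine ContinuousOn.congr (f := fun α => 1 / (s - 1) + ∑' n, hurwitzDefect s α n) ?_
    fun α hα => modifiedHurwitzZeta_eq_tsum hs hs' hα
  exact continuousOn_const.add (continuousOn_tsum (continuousOn_hurwitzDefect s)
    ((summable_nat_add_one_rpow hs).mul_left ‖s‖)
    fun n α hα => norm_hurwitzDefect_le hs1 hs hα n)

/-- Integrals of `ζ₁(s, ·)` against a continuous weight as limits of integrals over `[1, N + 1]`. -/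
theorem tendsto_integral_mul_modifiedHurwitzZeta {s : ℂ} (hs : 0 < s.re) (hs' : 0 < s.im)
    {φ : ℝ → ℂ} (hφ : Continuous φ) :
    Tendsto (fun N : ℕ => ∑ n ∈ Finset.range N, (∫ α in (0 : ℝ)..1,
        φ α * ((n + 1 + α : ℝ) : ℂ) ^ (-s))
        - ((N + 1 : ℝ) : ℂ) ^ (1 - s) / (1 - s) * ∫ α in (0 : ℝ)..1, φ α) atTop
      (nhds (∫ α in (0 : ℝ)..1, φ α * modifiedHurwitzZeta s α)) := by
  have hs1 : s ≠ 1 := by rintro rfl; simp at hs'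
  have hI : Set.uIcc (0 : ℝ) 1 = Set.Icc 0 1 := Set.uIcc_of_le zero_le_one
  have hI' : Set.uIoc (0 : ℝ) 1 ⊆ Set.Icc 0 1 := by
    rw [Set.uIoc_of_le zero_le_one]; exact Set.Ioc_subset_Icc_self
  obtain ⟨B, hB⟩ := isCompact_Icc.exists_bound_of_continuousOn (hφ.continuousOn (s := Set.Icc 0 1))
  have hB0 : 0 ≤ B := (norm_nonneg _).trans (hB 0 (by simp))
  have hsum := (summable_nat_add_one_rpow hs).mul_left ‖s‖
  have hd : ∀ n, ContinuousOn (fun α => φ α * hurwitzDefect s α n) (Set.Icc 0 1) := fun n =>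
    hφ.continuousOn.mul (continuousOn_hurwitzDefect s n)
  have key := intervalIntegral.hasSum_integral_of_dominated_convergence
    (μ := MeasureTheory.volume) (a := 0) (b := 1)
    (F := fun n α => φ α * hurwitzDefect s α n)
    (f := fun α => φ α * (modifiedHurwitzZeta s α - 1 / (s - 1)))
    (fun n _ => B * (‖s‖ * (n + 1 : ℝ) ^ (-s.re - 1)))
    (fun n => ((hd n).mono hI').aestronglyMeasurable measurableSet_uIoc)
    (fun n => Eventually.of_forall fun α hα => by
      rw [norm_mul]
      exact mul_le_mul (hB α (hI' hα)) (norm_hurwitzDefect_le hs1 hs (hI' hα) n)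
        (norm_nonneg _) hB0)
    (Eventually.of_forall fun α hα => hsum.mul_left B) (by simp)
    (Eventually.of_forall fun α hα => by
      rw [modifiedHurwitzZeta_eq_tsum hs hs' (hI' hα), add_sub_cancel_left]
      exact (Summable.of_norm_bounded hsum
        (norm_hurwitzDefect_le hs1 hs (hI' hα))).hasSum.mul_left (φ α))
  have hφi : IntervalIntegrable φ MeasureTheory.volume 0 1 := hφ.intervalIntegrable _ _
  have hfi : IntervalIntegrable (fun α => φ α * modifiedHurwitzZeta s α) MeasureTheory.volume 0 1 :=
    (hφ.continuousOn.mul (hI ▸ continuousOn_modifiedHurwitzZeta hs hs')).intervalIntegrable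
  have e1 : (∫ α in (0 : ℝ)..1, φ α * (modifiedHurwitzZeta s α - 1 / (s - 1)))
      = (∫ α in (0 : ℝ)..1, φ α * modifiedHurwitzZeta s α)
        - 1 / (s - 1) * ∫ α in (0 : ℝ)..1, φ α := by
    rw [← intervalIntegral.integral_const_mul, ← intervalIntegral.integral_sub hfi
      (hφi.const_mul _)]
    congr 1; ext α; ring
  rw [e1] at key
  have h2 := key.tendsto_sum_nat.add_const (1 / (s - 1) * ∫ α in (0 : ℝ)..1, φ α)
  rw [sub_add_cancel] at h2
  refine h2.congr fun N => ?_
  have hp : ∀ n : ℕ, IntervalIntegrable (fun α : ℝ => φ α * ((n + 1 + α : ℝ) : ℂ) ^ (-s))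
      MeasureTheory.volume 0 1 := fun n => by
    refine (hφ.continuousOn.mul (ContinuousOn.cpow_const (by fun_prop) fun α hα => ?_)
      ).intervalIntegrable
    rw [hI] at hα
    rw [ofReal_mem_slitPlane]
    have := hα.1
    positivity
  have hdi : ∀ n, IntervalIntegrable (fun α => φ α * hurwitzDefect s α n)
      MeasureTheory.volume 0 1 := fun n =>
    ContinuousOn.intervalIntegrable (by rw [hI]; exact hd n)
  have hS : IntervalIntegrable (fun α => ∑ n ∈ Finset.range N, φ α * hurwitzDefect s α n)
      MeasureTheory.volume 0 1 := by
    simpa only [Finset.sum_fn] using IntervalIntegrable.sum (Finset.range N) fun n _ => hdi n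
  have hT : IntervalIntegrable (fun α : ℝ => ∑ n ∈ Finset.range N,
      φ α * ((n + 1 + α : ℝ) : ℂ) ^ (-s)) MeasureTheory.volume 0 1 := by
    simpa only [Finset.sum_fn] using IntervalIntegrable.sum (Finset.range N) fun n _ => hp n
  rw [← intervalIntegral.integral_finsetSum fun n _ => hdi n,
    ← intervalIntegral.integral_finsetSum fun n _ => hp n,
    ← intervalIntegral.integral_const_mul, ← intervalIntegral.integral_const_mul,
    ← intervalIntegral.integral_add hS (hφi.const_mul _),
    ← intervalIntegral.integral_sub hT (hφi.const_mul _)]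
  congr 1
  ext α
  rw [← Finset.mul_sum, sum_hurwitzDefect, ← Finset.mul_sum]
  have : s - 1 ≠ 0 := sub_ne_zero.mpr hs1
  have : 1 - s ≠ 0 := sub_ne_zero.mpr hs1.symm
  have : 1 / (s - 1) = - (1 / (1 - s)) := by
    field_simp
    ring
  rw [this]
  ring

/-! ### Rotated Gamma integrals and the Mellin transform of the cosine. -/

theorem integrableOn_rpow_mul_exp_neg_mul_Ioi {σ b : ℝ} (hσ : -1 < σ) (hb : 0 < b) :
    MeasureTheory.IntegrableOn (fun x : ℝ => x ^ σ * Real.exp (-(b * x))) (Set.Ioi 0) := by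
  have := integrableOn_rpow_mul_exp_neg_mul_rpow (p := 1) hσ one_pos hb
  simpa using this

theorem continuousOn_ofReal_cpow (r : ℂ) : ContinuousOn (fun x : ℝ => (x : ℂ) ^ r) (Set.Ioi 0) :=
  ContinuousOn.cpow_const (by fun_prop) fun x hx => by
    rw [ofReal_mem_slitPlane]; exact hx

theorem norm_cpow_mul_exp_neg_mul {a r : ℂ} {x : ℝ} (hx : 0 < x) :
    ‖(x : ℂ) ^ a * cexp (-(r * x))‖ = x ^ a.re * Real.exp (-(r.re * x)) := by
  rw [norm_mul, norm_cpow_eq_rpow_re_of_pos hx, norm_exp]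
  simp

theorem integrableOn_cpow_mul_exp_neg_mul_Ioi {a r : ℂ} (ha : -1 < a.re) (hr : 0 < r.re) :
    MeasureTheory.IntegrableOn (fun x : ℝ => (x : ℂ) ^ a * cexp (-(r * x))) (Set.Ioi 0) := by
  refine MeasureTheory.Integrable.mono' (integrableOn_rpow_mul_exp_neg_mul_Ioi ha hr)
    (((continuousOn_ofReal_cpow a).mul (by fun_prop)).aestronglyMeasurable measurableSet_Ioi) ?_
  filter_upwards [MeasureTheory.ae_restrict_mem measurableSet_Ioi] with x hx
  exact (norm_cpow_mul_exp_neg_mul hx).le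

/-- The Gamma integral along a rotated ray: `∫₀^∞ x ^ (a - 1) e ^ (-r x) dx = (1 / r) ^ a Γ(a)` for
complex `r` in the right half plane. -/
theorem integral_cpow_mul_exp_neg_complex_mul_Ioi {a r : ℂ} (ha : 0 < a.re) (hr : 0 < r.re) :
    ∫ x in Set.Ioi (0 : ℝ), (x : ℂ) ^ (a - 1) * cexp (-(r * x)) = (1 / r) ^ a * Gamma a := by
  set U : Set ℂ := {z : ℂ | 0 < z.re} with hU
  have hUo : IsOpen U := isOpen_lt continuous_const continuous_re
  have hUc : IsPreconnected U := (convex_halfSpace_re_gt 0).isPreconnected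
  have hf : DifferentiableOn ℂ
      (fun r => ∫ x in Set.Ioi (0 : ℝ), (x : ℂ) ^ (a - 1) * cexp (-(r * x))) U := by
    intro z hz
    have hz' : 0 < z.re := hz
    have hs : {w : ℂ | z.re / 2 < w.re} ∈ nhds z :=
      (isOpen_lt continuous_const continuous_re).mem_nhds (show z.re / 2 < z.re by linarith)
    refine (hasDerivAt_integral_of_dominated_loc_of_deriv_le
      (μ := MeasureTheory.volume.restrict (Set.Ioi (0 : ℝ)))
      (F := fun r x => (x : ℂ) ^ (a - 1) * cexp (-(r * x)))
      (F' := fun r x => (x : ℂ) ^ (a - 1) * (cexp (-(r * x)) * (-x)))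
      (bound := fun x => x ^ a.re * Real.exp (-(z.re / 2 * x))) hs
      (Eventually.of_forall fun w => ((continuousOn_ofReal_cpow (a - 1)).mul
        (by fun_prop)).aestronglyMeasurable measurableSet_Ioi)
      (integrableOn_cpow_mul_exp_neg_mul_Ioi (by simpa using ha) hz)
      (((continuousOn_ofReal_cpow (a - 1)).mul
        (by fun_prop)).aestronglyMeasurable measurableSet_Ioi) ?_
      (integrableOn_rpow_mul_exp_neg_mul_Ioi (by linarith) (by linarith)) ?_
      ).2.differentiableAt.differentiableWithinAt
    · filter_upwards [MeasureTheory.ae_restrict_mem measurableSet_Ioi] with x hx w hw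
      have hx' : (0 : ℝ) < x := hx
      rw [← mul_assoc, norm_mul, norm_cpow_mul_exp_neg_mul hx', norm_neg, norm_real,
        Real.norm_of_nonneg hx'.le]
      rw [sub_re, one_re, mul_right_comm, ← Real.rpow_add_one hx'.ne', sub_add_cancel]
      have : z.re / 2 < w.re := hw
      gcongr
    · filter_upwards with x w hw
      have h : HasDerivAt (fun w : ℂ => -(w * x)) (-x) w := by
        exact (hasDerivAt_mul_const (x : ℂ)).fun_neg
      exact (h.cexp).const_mul _
  have hg : DifferentiableOn ℂ (fun r => (1 / r) ^ a * Gamma a) U := by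
    intro z hz
    have hz' : 0 < z.re := hz
    have hz0 : z ≠ 0 := by rintro rfl; simp at hz'
    refine DifferentiableAt.differentiableWithinAt (DifferentiableAt.mul_const ?_ _)
    refine DifferentiableAt.cpow_const ((differentiableAt_const _).div differentiableAt_id hz0) ?_
    left
    rw [one_div, inv_re]
    exact div_pos hz' (normSq_pos.mpr hz0)
  refine (hf.analyticOnNhd hUo).eqOn_of_preconnected_of_frequently_eq (hg.analyticOnNhd hUo) hUc
    (z₀ := 1) (by simp [hU]) ?_ hr
  -- For real `r > 0` the formula is a change of variable in the Gamma integral; agreement at real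
  -- points accumulating at `1` suffices for the identity theorem.
  have hu : Tendsto (fun n : ℕ => ((1 + 1 / ((n : ℝ) + 1) : ℝ) : ℂ)) atTop
      (nhdsWithin 1 {1}ᶜ) := by
    refine tendsto_nhdsWithin_iff.mpr ⟨?_, Eventually.of_forall fun n => ?_⟩
    · have := (tendsto_one_div_add_atTop_nhds_zero_nat (𝕜 := ℝ)).const_add 1
      have h2 := (continuous_ofReal.tendsto _).comp this
      simpa [Function.comp_def] using h2
    · have : (0 : ℝ) < 1 / ((n : ℝ) + 1) := by positivity
      simp only [Set.mem_compl_iff, Set.mem_singleton_iff]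
      intro h
      have : (1 + 1 / ((n : ℝ) + 1) : ℝ) = 1 := by exact_mod_cast h
      linarith
  refine hu.frequently (Frequently.of_forall fun n => ?_)
  exact integral_cpow_mul_exp_neg_mul_Ioi ha (by positivity)

theorem norm_cos_ofReal_le (x : ℝ) : ‖Complex.cos (x : ℂ)‖ ≤ 1 := by
  rw [← ofReal_cos, norm_real]
  exact Real.abs_cos_le_one x

theorem norm_sin_ofReal_le (x : ℝ) : ‖Complex.sin (x : ℂ)‖ ≤ 1 := by
  rw [← ofReal_sin, norm_real]
  exact Real.abs_sin_le_one x

/-- Splitting the cosine into exponentials moves the decay rate from `ε` to `ε ∓ iω`. The damping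
makes everything absolutely convergent; it is removed by `ε → 0⁺` in `integral_cpow_mul_cos`. -/
theorem integral_cos_mul_cpow_mul_exp {s : ℂ} (hs : s.re < 1) (ω : ℝ) {ε : ℝ} (hε : 0 < ε) :
    ∫ x in Set.Ioi (0 : ℝ), (x : ℂ) ^ (-s) * cexp (-(ε * x)) * Complex.cos ((ω * x : ℝ) : ℂ)
      = ((1 / (ε - ω * I)) ^ (1 - s) + (1 / (ε + ω * I)) ^ (1 - s)) / 2 * Gamma (1 - s) := by
  have h1 := integral_cpow_mul_exp_neg_complex_mul_Ioi (a := 1 - s) (r := ε - ω * I)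
    (by simpa using hs) (by simpa using hε)
  have h2 := integral_cpow_mul_exp_neg_complex_mul_Ioi (a := 1 - s) (r := ε + ω * I)
    (by simpa using hs) (by simpa using hε)
  have i1 := integrableOn_cpow_mul_exp_neg_mul_Ioi (a := 1 - s - 1) (r := ε - ω * I)
    (by simpa using hs) (by simpa using hε)
  have i2 := integrableOn_cpow_mul_exp_neg_mul_Ioi (a := 1 - s - 1) (r := ε + ω * I)
    (by simpa using hs) (by simpa using hε)
  rw [add_div, add_mul, div_mul_eq_mul_div, div_mul_eq_mul_div, ← h1, ← h2, ← add_div,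
    ← MeasureTheory.integral_add i1 i2, ← MeasureTheory.integral_div]
  refine MeasureTheory.setIntegral_congr_fun measurableSet_Ioi fun x _ => ?_
  simp only [sub_sub_cancel_left]
  rw [Complex.cos, ← mul_div_assoc, ← mul_add, mul_assoc, mul_add, ← Complex.exp_add, ← Complex.exp_add]
  congr 4
  · push_cast; ring
  · push_cast; ring

theorem hasDerivAt_sin_ofReal_mul (ω x : ℝ) :
    HasDerivAt (fun x : ℝ => Complex.sin ((ω * x : ℝ) : ℂ)) (ω * Complex.cos ((ω * x : ℝ) : ℂ)) x := by
  have h := (((hasDerivAt_const_mul (ω : ℂ)).csin : HasDerivAt (fun z : ℂ => Complex.sin (ω * z))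
    (Complex.cos (ω * x) * ω) (x : ℂ))).comp_ofReal
  simpa only [ofReal_mul, mul_comm (Complex.cos _)] using h

theorem hasDerivAt_cpow_neg_ofReal {s : ℂ} (hs : s ≠ 0) {x : ℝ} (hx : 0 < x) :
    HasDerivAt (fun x : ℝ => (x : ℂ) ^ (-s)) (-s * (x : ℂ) ^ (-s - 1)) x :=
  hasDerivAt_ofReal_cpow_const hx.ne' (neg_ne_zero.mpr hs)

theorem integrableOn_mul_sin {f : ℝ → ℂ} {S : Set ℝ} (hf : MeasureTheory.IntegrableOn f S) (ω : ℝ) :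
    MeasureTheory.IntegrableOn (fun x => f x * Complex.sin ((ω * x : ℝ) : ℂ)) S :=
  MeasureTheory.Integrable.mul_bdd (c := 1) hf
    (Continuous.aestronglyMeasurable (by fun_prop)) (Eventually.of_forall fun x => norm_sin_ofReal_le _)

theorem integrableOn_mul_cos {f : ℝ → ℂ} {S : Set ℝ} (hf : MeasureTheory.IntegrableOn f S) (ω : ℝ) :
    MeasureTheory.IntegrableOn (fun x => f x * Complex.cos ((ω * x : ℝ) : ℂ)) S :=
  MeasureTheory.Integrable.mul_bdd (c := 1) hf
    (Continuous.aestronglyMeasurable (by fun_prop)) (Eventually.of_forall fun x => norm_cos_ofReal_le _)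

theorem integrableOn_Ioi_one_cpow_mul_exp (r : ℂ) {ε : ℝ} (hε : 0 < ε) :
    MeasureTheory.IntegrableOn (fun x : ℝ => (x : ℂ) ^ r * cexp (-(ε * x))) (Set.Ioi 1) := by
  have h0 : MeasureTheory.IntegrableOn (fun x : ℝ => x ^ max r.re 0 * Real.exp (-(ε * x)))
      (Set.Ioi 1) := (integrableOn_rpow_mul_exp_neg_mul_Ioi
        (lt_of_lt_of_le (by norm_num) (le_max_right _ _)) hε).mono_set
        (Set.Ioi_subset_Ioi zero_le_one)
  refine MeasureTheory.Integrable.mono' h0 ((((continuousOn_ofReal_cpow r).mono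
    (Set.Ioi_subset_Ioi zero_le_one)).mul (by fun_prop)).aestronglyMeasurable measurableSet_Ioi) ?_
  filter_upwards [MeasureTheory.ae_restrict_mem measurableSet_Ioi] with x hx
  have hx' : (1 : ℝ) < x := hx
  rw [norm_cpow_mul_exp_neg_mul (by linarith)]
  simp only [ofReal_re]
  gcongr
  · exact hx'.le
  · exact le_max_left _ _

theorem tendsto_cpow_mul_exp_neg_atTop (r : ℂ) {ε : ℝ} (hε : 0 < ε) :
    Tendsto (fun x : ℝ => (x : ℂ) ^ r * cexp (-(ε * x))) atTop (nhds 0) := by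
  rw [tendsto_zero_iff_norm_tendsto_zero]
  refine (tendsto_rpow_mul_exp_neg_mul_atTop_nhds_zero r.re ε hε).congr' ?_
  filter_upwards [eventually_gt_atTop 0] with x hx
  rw [norm_cpow_mul_exp_neg_mul hx]
  simp

/-- Integration by parts on `[1, ∞)` against a cosine whose sine vanishes at `1`. -/
theorem integral_Ioi_one_mul_cos {s : ℂ} (hs : s ≠ 0) {ω : ℝ} (hω : ω ≠ 0)
    (hsin : Complex.sin (ω : ℂ) = 0) {ε : ℝ} (hε : 0 < ε) :
    ∫ x in Set.Ioi (1 : ℝ), (x : ℂ) ^ (-s) * cexp (-(ε * x)) * Complex.cos ((ω * x : ℝ) : ℂ)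
      = s / ω * (∫ x in Set.Ioi (1 : ℝ),
          (x : ℂ) ^ (-s - 1) * cexp (-(ε * x)) * Complex.sin ((ω * x : ℝ) : ℂ))
        + ε / ω * ∫ x in Set.Ioi (1 : ℝ),
          (x : ℂ) ^ (-s) * cexp (-(ε * x)) * Complex.sin ((ω * x : ℝ) : ℂ) := by
  have hω' : (ω : ℂ) ≠ 0 := ofReal_ne_zero.mpr hω
  have i1 := integrableOn_mul_cos (integrableOn_Ioi_one_cpow_mul_exp (-s) hε) ω
  have i2 := integrableOn_mul_sin (integrableOn_Ioi_one_cpow_mul_exp (-s - 1) hε) ω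
  have i3 := integrableOn_mul_sin (integrableOn_Ioi_one_cpow_mul_exp (-s) hε) ω
  have i23 : MeasureTheory.IntegrableOn (fun x : ℝ =>
      s * ((x : ℂ) ^ (-s - 1) * cexp (-(ε * x)) * Complex.sin ((ω * x : ℝ) : ℂ))
      + ε * ((x : ℂ) ^ (-s) * cexp (-(ε * x)) * Complex.sin ((ω * x : ℝ) : ℂ))) (Set.Ioi 1) :=
    (i2.const_mul _).add (i3.const_mul _)
  have key := MeasureTheory.integral_Ioi_of_hasDerivAt_of_tendsto' (a := 1) (m := 0)
    (f := fun x : ℝ => (x : ℂ) ^ (-s) * cexp (-(ε * x)) * Complex.sin ((ω * x : ℝ) : ℂ))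
    (f' := fun x : ℝ => ω * ((x : ℂ) ^ (-s) * cexp (-(ε * x)) * Complex.cos ((ω * x : ℝ) : ℂ))
      - (s * ((x : ℂ) ^ (-s - 1) * cexp (-(ε * x)) * Complex.sin ((ω * x : ℝ) : ℂ))
      + ε * ((x : ℂ) ^ (-s) * cexp (-(ε * x)) * Complex.sin ((ω * x : ℝ) : ℂ))))
    (fun x hx => ?_)
    ((i1.const_mul _).sub i23) ?_
  · rw [MeasureTheory.integral_sub (i1.const_mul _) i23,
      MeasureTheory.integral_add (i2.const_mul _) (i3.const_mul _),
      MeasureTheory.integral_const_mul, MeasureTheory.integral_const_mul,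
      MeasureTheory.integral_const_mul] at key
    simp only [mul_one, hsin, mul_zero, sub_zero] at key
    rw [div_mul_eq_mul_div, div_mul_eq_mul_div, ← add_div, eq_div_iff hω', mul_comm]
    exact sub_eq_zero.mp key
  · have hx0 : (0 : ℝ) < x := lt_of_lt_of_le one_pos hx
    have he : HasDerivAt (fun x : ℝ => cexp (-(ε * x))) (cexp (-(ε * x)) * (-ε)) x := by
      have h : HasDerivAt (fun x : ℝ => -((ε : ℂ) * x)) (-ε : ℂ) x := by
        have := ((hasDerivAt_id x).const_mul ε).ofReal_comp.fun_neg
        simpa using this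
      exact h.cexp
    convert! ((hasDerivAt_cpow_neg_ofReal hs hx0).mul he).mul (hasDerivAt_sin_ofReal_mul ω x) using 1
    simp only [Pi.mul_apply]
    ring
  · refine squeeze_zero_norm (fun x => ?_)
      (tendsto_zero_iff_norm_tendsto_zero.mp (tendsto_cpow_mul_exp_neg_atTop (-s) hε))
    rw [norm_mul]
    exact mul_le_of_le_one_right (norm_nonneg _) (norm_sin_ofReal_le _)

theorem integrableOn_Ioc_cpow_neg {s : ℂ} (hs : s.re < 1) :
    MeasureTheory.IntegrableOn (fun x : ℝ => (x : ℂ) ^ (-s)) (Set.Ioc 0 1) := by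
  rw [← intervalIntegrable_iff_integrableOn_Ioc_of_le zero_le_one]
  exact intervalIntegral.intervalIntegrable_cpow' (by simpa using hs)

theorem tendsto_integral_Ioc_mul_exp {f : ℝ → ℂ} {S : Set ℝ} (hS : S ⊆ Set.Ioi 0)
    (hSm : MeasurableSet S) (hf : MeasureTheory.IntegrableOn f S) :
    Tendsto (fun ε : ℝ => ∫ x in S, f x * cexp (-(ε * x))) (nhdsWithin 0 (Set.Ioi 0))
      (nhds (∫ x in S, f x)) := by
  refine MeasureTheory.tendsto_integral_filter_of_dominated_convergence (fun x => ‖f x‖)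
    (Eventually.of_forall fun ε => hf.aestronglyMeasurable.mul
      (Continuous.aestronglyMeasurable (by fun_prop))) ?_ hf.norm ?_
  · filter_upwards [self_mem_nhdsWithin] with ε hε
    filter_upwards [MeasureTheory.ae_restrict_mem hSm] with x hx
    rw [norm_mul]
    refine mul_le_of_le_one_right (norm_nonneg _) ?_
    rw [norm_exp]
    have h1 : (0 : ℝ) < ε := hε
    have h2 : (0 : ℝ) < x := hS hx
    simp only [neg_re, mul_re, ofReal_re, ofReal_im, mul_zero, sub_zero]
    exact Real.exp_le_one_iff.mpr (by nlinarith)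
  · refine Eventually.of_forall fun x => ?_
    have h : Continuous fun ε : ℝ => f x * cexp (-(ε * x)) := by fun_prop
    have := (h.tendsto 0).mono_left (nhdsWithin_le_nhds (s := Set.Ioi 0))
    simpa using this

/-- The Fresnel-type integral `∫₀^∞ x ^ (-s) cos (ω x) dx`, with the conditionally convergent part
over `[1, ∞)` integrated by parts. -/
theorem integral_cpow_mul_cos {s : ℂ} (hs0 : 0 < s.re) (hs : s.re < 1) {ω : ℝ} (hω : 0 < ω)
    (hsin : Complex.sin (ω : ℂ) = 0) :
    (∫ x in (0 : ℝ)..1, (x : ℂ) ^ (-s) * Complex.cos ((ω * x : ℝ) : ℂ))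
      + s / ω * ∫ x in Set.Ioi (1 : ℝ), (x : ℂ) ^ (-s - 1) * Complex.sin ((ω * x : ℝ) : ℂ)
      = ((1 / (0 - ω * I)) ^ (1 - s) + (1 / (0 + ω * I)) ^ (1 - s)) / 2 * Gamma (1 - s) := by
  have hsne : s ≠ 0 := by rintro rfl; simp at hs0
  have hωc : (ω : ℂ) ≠ 0 := ofReal_ne_zero.mpr hω.ne'
  have t1 := tendsto_integral_Ioc_mul_exp (S := Set.Ioc 0 1) (fun x hx => hx.1) measurableSet_Ioc
    (integrableOn_mul_cos (integrableOn_Ioc_cpow_neg hs) ω)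
  have t2 := tendsto_integral_Ioc_mul_exp (S := Set.Ioi 1) (Set.Ioi_subset_Ioi zero_le_one)
    measurableSet_Ioi (integrableOn_mul_sin
      (integrableOn_Ioi_cpow_of_lt (a := -s - 1) (by rw [sub_re, neg_re, one_re]; linarith) one_pos) ω)
  -- The integral is at most of order `ε ^ (σ - 1)` with `σ = Re s`, so the prefactor leaves `ε ^ σ
  -- → 0`.
  have t3 : Tendsto (fun ε : ℝ => ε / ω * ∫ x in Set.Ioi (1 : ℝ),
      (x : ℂ) ^ (-s) * cexp (-(ε * x)) * Complex.sin ((ω * x : ℝ) : ℂ))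
      (nhdsWithin 0 (Set.Ioi 0)) (nhds 0) := by
    have hz : Tendsto (fun ε : ℝ => ω⁻¹ * Real.Gamma (1 - s.re) * ε ^ s.re)
        (nhdsWithin 0 (Set.Ioi 0)) (nhds 0) := by
      have hc : Continuous fun ε : ℝ => ω⁻¹ * Real.Gamma (1 - s.re) * ε ^ s.re :=
        continuous_const.mul (Real.continuous_rpow_const hs0.le)
      have := (hc.tendsto 0).mono_left (nhdsWithin_le_nhds (s := Set.Ioi 0))
      simpa [Real.zero_rpow hs0.ne'] using this
    refine squeeze_zero_norm' ?_ hz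
    filter_upwards [self_mem_nhdsWithin] with ε hε
    have hε' : (0 : ℝ) < ε := hε
    have hG : ‖∫ x in Set.Ioi (1 : ℝ),
        (x : ℂ) ^ (-s) * cexp (-(ε * x)) * Complex.sin ((ω * x : ℝ) : ℂ)‖
        ≤ (1 / ε) ^ (1 - s.re) * Real.Gamma (1 - s.re) := by
      rw [← Real.integral_rpow_mul_exp_neg_mul_Ioi (by linarith) hε']
      have hint := integrableOn_rpow_mul_exp_neg_mul_Ioi (σ := 1 - s.re - 1) (by linarith) hε'
      refine (MeasureTheory.norm_integral_le_of_norm_le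
        (hint.mono_set (Set.Ioi_subset_Ioi zero_le_one)) ?_).trans
        (MeasureTheory.setIntegral_mono_set hint ?_
          ((Set.Ioi_subset_Ioi zero_le_one).eventuallyLE))
      · filter_upwards [MeasureTheory.ae_restrict_mem measurableSet_Ioi] with x hx
        have hx' : (0 : ℝ) < x := lt_trans one_pos hx
        rw [norm_mul, norm_cpow_mul_exp_neg_mul hx']
        refine (mul_le_of_le_one_right (by positivity) (norm_sin_ofReal_le _)).trans_eq ?_
        simp
      · filter_upwards [MeasureTheory.ae_restrict_mem measurableSet_Ioi] with x hx
        have hx' : (0 : ℝ) < x := hx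
        simp only [Pi.zero_apply]
        positivity
    rw [norm_mul, norm_div, norm_real, norm_real, Real.norm_of_nonneg hε'.le,
      Real.norm_of_nonneg hω.le]
    calc _ ≤ ε / ω * ((1 / ε) ^ (1 - s.re) * Real.Gamma (1 - s.re)) := by gcongr
      _ = ω⁻¹ * Real.Gamma (1 - s.re) * (ε * (1 / ε) ^ (1 - s.re)) := by ring
      _ = _ := by
        rw [one_div, Real.inv_rpow hε'.le, ← Real.rpow_neg hε'.le, ← Real.rpow_one_add' hε'.le]
        · congr 2; ring
        · intro h; linarith
  have t4 : Tendsto (fun ε : ℝ =>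
      ((1 / (ε - ω * I)) ^ (1 - s) + (1 / (ε + ω * I)) ^ (1 - s)) / 2 * Gamma (1 - s))
      (nhdsWithin 0 (Set.Ioi 0))
      (nhds (((1 / (0 - ω * I)) ^ (1 - s) + (1 / (0 + ω * I)) ^ (1 - s)) / 2 * Gamma (1 - s))) := by
    have hωI : (ω : ℂ) * I ≠ 0 := mul_ne_zero hωc I_ne_zero
    -- At `ε = 0` the bases are `±i/ω`, off the branch cut, so the principal powers are continuous
    -- there.
    have c1 : ContinuousAt (fun ε : ℝ => (1 / ((ε : ℂ) - ω * I)) ^ (1 - s)) 0 := by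
      refine ContinuousAt.cpow (ContinuousAt.div (by fun_prop) (by fun_prop) ?_) continuousAt_const ?_
      · simpa using hω.ne'
      · right
        simp [normSq, hω.ne']
    have c2 : ContinuousAt (fun ε : ℝ => (1 / ((ε : ℂ) + ω * I)) ^ (1 - s)) 0 := by
      refine ContinuousAt.cpow (ContinuousAt.div (by fun_prop) (by fun_prop) ?_) continuousAt_const ?_
      · simpa using hω.ne'
      · right
        simp [normSq, hω.ne']
    have := (((c1.add c2).div_const 2).mul_const (Gamma (1 - s))).tendsto.mono_left
      (nhdsWithin_le_nhds (s := Set.Ioi 0))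
    simpa using this
  refine tendsto_nhds_unique ?_ t4
  have t5 := (t1.add (t2.const_mul (s / ω))).add t3
  rw [add_zero, ← intervalIntegral.integral_of_le zero_le_one] at t5
  refine t5.congr' ?_
  filter_upwards [self_mem_nhdsWithin] with ε hε
  have hε' : (0 : ℝ) < ε := hε
  rw [← integral_cos_mul_cpow_mul_exp hs ω hε', ← Set.Ioc_union_Ioi_eq_Ioi zero_le_one,
    MeasureTheory.setIntegral_union (Set.Ioc_disjoint_Ioi le_rfl) measurableSet_Ioi,
    integral_Ioi_one_mul_cos hsne hω.ne' hsin hε', add_assoc]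
  · congr 1
    · exact MeasureTheory.integral_congr_ae (Eventually.of_forall fun x => by simp only []; ring)
    · congr 2
      exact MeasureTheory.integral_congr_ae (Eventually.of_forall fun x => by simp only []; ring)
  · exact (integrableOn_mul_cos (integrableOn_cpow_mul_exp_neg_mul_Ioi (by simpa using hs)
      (by simpa using hε')) ω).mono_set fun x hx => hx.1
  · exact integrableOn_mul_cos (integrableOn_Ioi_one_cpow_mul_exp _ hε') ω

/-! ### Cosine coefficients of `ζ₁(s, ·)` and the functional equation factor. -/

theorem sin_two_pi_mul_nat (n : ℕ) : Complex.sin ((2 * Real.pi * n : ℝ) : ℂ) = 0 := by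
  rw [← ofReal_sin, show 2 * Real.pi * n = ((2 * n : ℕ) : ℝ) * Real.pi by push_cast; ring,
    Real.sin_nat_mul_pi, ofReal_zero]

/-- The cosine has period `1`, so the shifts by `n + 1` glue the unit intervals together. The case
`m = 0` is used too, for the mean of `ζ₁`. -/
theorem sum_integral_cos_mul_cpow (s : ℂ) (m N : ℕ) :
    ∑ n ∈ Finset.range N, (∫ α in (0 : ℝ)..1,
        Complex.cos ((2 * Real.pi * m * α : ℝ) : ℂ) * ((n + 1 + α : ℝ) : ℂ) ^ (-s))
      = ∫ x in (1 : ℝ)..(N + 1),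
        (x : ℂ) ^ (-s) * Complex.cos ((2 * Real.pi * m * x : ℝ) : ℂ) := by
  have hc : ContinuousOn (fun x : ℝ => (x : ℂ) ^ (-s) *
      Complex.cos ((2 * Real.pi * m * x : ℝ) : ℂ)) (Set.Ioi 0) :=
    (continuousOn_ofReal_cpow (-s)).mul (by fun_prop)
  have h := intervalIntegral.sum_integral_adjacent_intervals (μ := MeasureTheory.volume)
    (f := fun x : ℝ => (x : ℂ) ^ (-s) * Complex.cos ((2 * Real.pi * m * x : ℝ) : ℂ))
    (a := fun n : ℕ => (n + 1 : ℝ)) (n := N) (fun k _ => by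
      refine (hc.mono fun x hx => ?_).intervalIntegrable
      rw [Set.uIcc_of_le (by push_cast; linarith)] at hx
      exact lt_of_lt_of_le (by positivity) hx.1)
  simp only [Nat.cast_zero, zero_add] at h
  rw [← h]
  refine Finset.sum_congr rfl fun n _ => ?_
  have e := intervalIntegral.integral_comp_add_left (a := 0) (b := 1)
    (fun x : ℝ => (x : ℂ) ^ (-s) * Complex.cos ((2 * Real.pi * m * x : ℝ) : ℂ)) (n + 1 : ℝ)
  rw [add_zero] at e
  push_cast at e ⊢
  rw [← e]
  congr 1
  ext α
  rw [mul_comm]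
  congr 1
  rw [show 2 * (Real.pi : ℂ) * m * (n + 1 + α) = 2 * Real.pi * m * α + (m * (n + 1) : ℕ) * (2 * Real.pi)
    by push_cast; ring, Complex.cos_add_nat_mul_two_pi]

/-- The Fourier cosine coefficients of `ζ₁(s, ·)` over `[0, 1]`. -/
theorem integral_cos_mul_modifiedHurwitzZeta {s : ℂ} (hs : 0 < s.re) (hs' : 0 < s.im) {m : ℕ}
    (hm : m ≠ 0) :
    ∫ α in (0 : ℝ)..1, Complex.cos ((2 * Real.pi * m * α : ℝ) : ℂ) * modifiedHurwitzZeta s α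
      = s / (2 * Real.pi * m : ℝ) * ∫ x in Set.Ioi (1 : ℝ),
        (x : ℂ) ^ (-s - 1) * Complex.sin ((2 * Real.pi * m * x : ℝ) : ℂ) := by
  set ω : ℝ := 2 * Real.pi * m with hω
  have hω0 : (ω : ℂ) ≠ 0 := by
    rw [hω]
    have := Real.pi_pos.ne'
    exact_mod_cast (by positivity : (2 * Real.pi * m : ℝ) ≠ 0)
  have hs0 : s ≠ 0 := by rintro rfl; simp at hs
  have h1 := tendsto_integral_mul_modifiedHurwitzZeta hs hs'
    (φ := fun α : ℝ => Complex.cos ((ω * α : ℝ) : ℂ)) (by fun_prop)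
  have h0 : ∫ α in (0 : ℝ)..1, Complex.cos ((ω * α : ℝ) : ℂ) = 0 := by
    have := intervalIntegral.integral_eq_sub_of_hasDerivAt (a := 0) (b := 1)
      (fun x _ => hasDerivAt_sin_ofReal_mul ω x) (Continuous.intervalIntegrable (by fun_prop) _ _)
    rw [intervalIntegral.integral_const_mul, mul_one, mul_zero, hω, sin_two_pi_mul_nat, ofReal_zero,
      Complex.sin_zero, sub_zero, ← hω] at this
    exact (mul_eq_zero.mp this).resolve_left hω0
  rw [h0] at h1
  simp only [mul_zero, sub_zero, hω, sum_integral_cos_mul_cpow] at h1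
  rw [← hω] at h1
  have h2 := (MeasureTheory.intervalIntegral_tendsto_integral_Ioi (l := atTop)
    (b := fun N : ℕ => (N + 1 : ℝ)) 1 (integrableOn_mul_sin
      (integrableOn_Ioi_cpow_of_lt (a := -s - 1) (by rw [sub_re, neg_re, one_re]; linarith)
        one_pos) ω)
    (tendsto_atTop_add_const_right atTop (1 : ℝ) tendsto_natCast_atTop_atTop)).const_mul (s / ω)
  -- The upper boundary term of the integration by parts on `[1, N + 1]`; decay of the power is
  -- enough. The term at `1` vanishes with the sine.
  have h3 : Tendsto (fun N : ℕ => ((N + 1 : ℝ) : ℂ) ^ (-s) *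
      Complex.sin ((ω * (N + 1 : ℝ) : ℝ) : ℂ) / ω) atTop (nhds 0) := by
    refine squeeze_zero_norm (a := fun N : ℕ => ‖((N + 1 : ℝ) : ℂ) ^ (-s)‖ * ‖(ω : ℂ)‖⁻¹) ?_ ?_
    · intro N
      rw [norm_div, norm_mul, div_eq_mul_inv]
      gcongr
      exact mul_le_of_le_one_right (norm_nonneg _) (norm_sin_ofReal_le _)
    · have := (tendsto_zero_iff_norm_tendsto_zero.mp
        (tendsto_nat_add_one_cpow (r := -s) (by simpa using hs))).mul_const (‖(ω : ℂ)‖⁻¹)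
      simpa using this
  refine tendsto_nhds_unique h1 ?_
  have h4 := h3.add h2
  rw [zero_add] at h4
  refine h4.congr fun N => ?_
  have hpos : ∀ x ∈ Set.uIcc (1 : ℝ) (N + 1), 0 < x := fun x hx => by
    rw [Set.uIcc_of_le (by simp)] at hx
    exact lt_of_lt_of_le one_pos hx.1
  have hint : ∀ r : ℂ, ∀ g : ℝ → ℂ, Continuous g → IntervalIntegrable
      (fun x : ℝ => (x : ℂ) ^ r * g x) MeasureTheory.volume 1 (N + 1) := fun r g hg =>
    (((continuousOn_ofReal_cpow r).mono hpos).mul hg.continuousOn).intervalIntegrable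
  have i1 := (hint (-s - 1) (fun x => Complex.sin ((ω * x : ℝ) : ℂ)) (by fun_prop)).const_mul (-s)
  have i2 := (hint (-s) (fun x => Complex.cos ((ω * x : ℝ) : ℂ)) (by fun_prop)).const_mul ω
  have key := intervalIntegral.integral_eq_sub_of_hasDerivAt (a := 1) (b := N + 1)
    (f := fun x : ℝ => (x : ℂ) ^ (-s) * Complex.sin ((ω * x : ℝ) : ℂ))
    (f' := fun x : ℝ => -s * ((x : ℂ) ^ (-s - 1) * Complex.sin ((ω * x : ℝ) : ℂ)) +
      ω * ((x : ℂ) ^ (-s) * Complex.cos ((ω * x : ℝ) : ℂ)))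
    (fun x hx => by
      convert! (hasDerivAt_cpow_neg_ofReal hs0 (hpos x hx)).mul (hasDerivAt_sin_ofReal_mul ω x)
        using 1
      ring) (i1.add i2)
  rw [intervalIntegral.integral_add i1 i2, intervalIntegral.integral_const_mul,
    intervalIntegral.integral_const_mul, mul_one] at key
  nth_rewrite 3 [hω] at key
  rw [sin_two_pi_mul_nat, mul_zero, sub_zero] at key
  rw [← key]
  field_simp
  ring

/-- The factor of the functional equation `ζ(s) = χ(s) ζ(1 - s)`. -/
noncomputable def zetaChi (s : ℂ) : ℂ :=
  2 * Gamma (1 - s) * (2 * Real.pi : ℝ) ^ (s - 1) * Complex.cos (Real.pi * (1 - s) / 2)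

/-- The bases are `±i/ω`, with principal logarithms `-log ω ± iπ/2`. -/
theorem one_div_mul_I_cpow_add {ω : ℝ} (hω : 0 < ω) (w : ℂ) :
    (1 / (0 - ω * I)) ^ w + (1 / (0 + ω * I)) ^ w
      = 2 * (ω : ℂ) ^ (-w) * Complex.cos (Real.pi * w / 2) := by
  have hω0 : (ω : ℂ) ≠ 0 := ofReal_ne_zero.mpr hω.ne'
  have hi : 0 < ω⁻¹ := inv_pos.mpr hω
  have e1 : 1 / (0 - ω * I) = (ω⁻¹ : ℝ) * I := by
    rw [zero_sub, one_div, inv_neg, mul_inv, inv_I, ofReal_inv]; ring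
  have e2 : 1 / (0 + ω * I) = (ω⁻¹ : ℝ) * (-I) := by
    rw [zero_add, one_div, mul_inv, inv_I, ofReal_inv]
  have n1 : ((ω⁻¹ : ℝ) : ℂ) * I ≠ 0 := mul_ne_zero (ofReal_ne_zero.mpr hi.ne') I_ne_zero
  have n2 : ((ω⁻¹ : ℝ) : ℂ) * (-I) ≠ 0 :=
    mul_ne_zero (ofReal_ne_zero.mpr hi.ne') (neg_ne_zero.mpr I_ne_zero)
  rw [e1, e2, cpow_def_of_ne_zero n1, cpow_def_of_ne_zero n2, cpow_def_of_ne_zero hω0,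
    log_ofReal_mul hi I_ne_zero, log_ofReal_mul hi (neg_ne_zero.mpr I_ne_zero), log_I, log_neg_I,
    Real.log_inv, Complex.cos, ← ofReal_log hω.le]
  rw [mul_assoc, mul_div_assoc', mul_add, ← Complex.exp_add, ← Complex.exp_add, mul_div_assoc',
    mul_add, mul_comm 2, mul_comm 2, ← add_mul, mul_div_cancel_right₀ _ two_ne_zero]
  congr 2
  · push_cast; ring
  · push_cast; ring

/-- The functional equation for the Fourier coefficients: the coefficients of the full Hurwitz zeta
function `ζ₁(s, α) + α ^ (-s)`. -/
theorem integral_two_cos_mul_modifiedHurwitzZeta_add {s : ℂ} (hs : 0 < s.re) (hs1 : s.re < 1)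
    (hs' : 0 < s.im) {m : ℕ} (hm : m ≠ 0) :
    (∫ α in (0 : ℝ)..1, 2 * Complex.cos ((2 * Real.pi * m * α : ℝ) : ℂ) * modifiedHurwitzZeta s α)
      + (∫ x in (0 : ℝ)..1, 2 * Complex.cos ((2 * Real.pi * m * x : ℝ) : ℂ) * (x : ℂ) ^ (-s))
      = zetaChi s * (m : ℂ) ^ (s - 1) := by
  have hω : 0 < 2 * Real.pi * m := by
    have := Real.pi_pos
    positivity
  have h1 := integral_cos_mul_modifiedHurwitzZeta hs hs' hm
  have h2 := integral_cpow_mul_cos hs hs1 hω (sin_two_pi_mul_nat m)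
  rw [← h1, one_div_mul_I_cpow_add hω, neg_sub] at h2
  simp_rw [mul_assoc (2 : ℂ)]
  rw [intervalIntegral.integral_const_mul, intervalIntegral.integral_const_mul, ← mul_add, add_comm]
  simp_rw [mul_comm (Complex.cos _) (_ ^ (-s))]
  rw [h2, zetaChi, ofReal_mul, mul_cpow_ofReal_nonneg (by positivity) (by positivity), ofReal_natCast]
  ring

/-- On the critical line `1 - s` is the conjugate of `s`. The reflection formula then gives `|Γ(1 -
s)|² = π / |sin πs|`, the double angle formula gives `|cos(π(1 - s)/2)|² = |sin πs| / 2`, and `|(2π)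
^ (s - 1)|² = 1/(2π)`. With the square of the factor `2` the product is `1`. -/
theorem norm_zetaChi_one_half_add (t : ℝ) : ‖zetaChi (1 / 2 + t * I)‖ = 1 := by
  set s : ℂ := 1 / 2 + t * I with hs
  have hconj : (starRingEnd ℂ) (1 - s) = s := by
    simp [hs, Complex.ext_iff]
    norm_num
  have hG : ‖Gamma (1 - s)‖ ^ 2 * ‖Complex.sin (Real.pi * s)‖ = Real.pi := by
    have h := Gamma_mul_Gamma_one_sub s
    have hre : s.re = 1 / 2 := by simp [hs]
    have hsin : Complex.sin (Real.pi * s) ≠ 0 := by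
      intro h0
      rw [h0, div_zero] at h
      exact mul_ne_zero (Gamma_ne_zero_of_re_pos (by rw [hre]; norm_num))
        (Gamma_ne_zero_of_re_pos (by rw [sub_re, one_re, hre]; norm_num)) h
    have hn := congrArg norm h
    rw [norm_mul, norm_div, norm_real, Real.norm_of_nonneg Real.pi_pos.le] at hn
    nth_rewrite 1 [← hconj] at hn
    rw [Gamma_conj, norm_conj, ← sq] at hn
    rw [hn, div_mul_cancel₀ _ (norm_ne_zero_iff.mpr hsin)]
  have hC : 2 * ‖Complex.cos (Real.pi * (1 - s) / 2)‖ ^ 2 = ‖Complex.sin (Real.pi * s)‖ := by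
    have e : (starRingEnd ℂ) (Complex.cos (Real.pi * (1 - s) / 2)) = Complex.cos (Real.pi * s / 2) := by
      rw [← Complex.cos_conj, map_div₀, map_mul, hconj, conj_ofReal, map_ofNat]
    have h : 2 * (Complex.cos (Real.pi * (1 - s) / 2) * Complex.cos (Real.pi * s / 2))
        = Complex.sin (Real.pi * s) := by
      have ha := Complex.cos_add (Real.pi * (1 - s) / 2) (Real.pi * s / 2)
      have hb := Complex.cos_sub (Real.pi * (1 - s) / 2) (Real.pi * s / 2)
      rw [show (Real.pi : ℂ) * (1 - s) / 2 + Real.pi * s / 2 = Real.pi / 2 by ring,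
        Complex.cos_pi_div_two] at ha
      rw [show (Real.pi : ℂ) * (1 - s) / 2 - Real.pi * s / 2 = Real.pi / 2 - Real.pi * s by ring,
        Complex.cos_pi_div_two_sub] at hb
      rw [hb]
      linear_combination -ha
    rw [← h, ← e, norm_mul, norm_mul, norm_conj, ← sq]
    simp
  have hP : ‖((2 * Real.pi : ℝ) : ℂ) ^ (s - 1)‖ ^ 2 = (2 * Real.pi)⁻¹ := by
    rw [norm_cpow_eq_rpow_re_of_pos (by positivity), ← Real.rpow_natCast, ← Real.rpow_mul
      (by positivity), ← Real.rpow_neg_one]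
    congr 1
    simp [hs]
    norm_num
  rw [← sq_eq_sq₀ (norm_nonneg _) zero_le_one, zetaChi, norm_mul, norm_mul, norm_mul, mul_pow,
    mul_pow, mul_pow, hP]
  have hpi := Real.pi_pos
  simp only [norm_ofNat]
  generalize ‖Complex.cos (Real.pi * (1 - s) / 2)‖ = c at hC ⊢
  field_simp
  linear_combination hG + ‖Gamma (1 - s)‖ ^ 2 * hC

/-! ### The exponential kernel: size, Green's formula, Fourier series. -/

/-- On `[0, 1]`, the periodization of `(c / 2) e ^ (-c |x|)`. -/
noncomputable def expKernel (c α : ℝ) : ℝ := c / 2 * Real.cosh (c * (α - 1 / 2)) / Real.sinh (c / 2)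

/-- The derivative of `expKernel`. -/
noncomputable def expKernelDeriv (c α : ℝ) : ℝ :=
  c ^ 2 / 2 * Real.sinh (c * (α - 1 / 2)) / Real.sinh (c / 2)

theorem continuous_expKernel (c : ℝ) : Continuous (expKernel c) := by
  unfold expKernel; fun_prop

theorem continuous_expKernelDeriv (c : ℝ) : Continuous (expKernelDeriv c) := by
  unfold expKernelDeriv; fun_prop

theorem expKernel_nonneg {c : ℝ} (hc : 0 < c) (α : ℝ) : 0 ≤ expKernel c α := by
  have := Real.sinh_pos_iff.mpr (half_pos hc)
  have := Real.cosh_pos (c * (α - 1 / 2))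
  unfold expKernel
  positivity

theorem expKernel_one (c : ℝ) : expKernel c 1 = expKernel c 0 := by
  unfold expKernel
  rw [show c * (1 - 1 / 2) = -(c * (0 - 1 / 2)) by ring, Real.cosh_neg]

/-- The maximum on `[0, 1]` is at the end points, with value `(c / 2) coth (c / 2)`; once `e ^ (c /
2) ≥ 2` the hyperbolic cotangent is at most `2`. -/
theorem expKernel_le {c : ℝ} (hc : 2 ≤ c) {α : ℝ} (hα : α ∈ Set.Icc (0 : ℝ) 1) :
    expKernel c α ≤ c := by
  have hs := Real.sinh_pos_iff.mpr (half_pos (lt_of_lt_of_le two_pos hc))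
  have h1 : Real.cosh (c * (α - 1 / 2)) ≤ Real.cosh (c / 2) := by
    rw [Real.cosh_le_cosh, abs_mul, abs_of_pos (by linarith : 0 < c), abs_of_pos (by linarith : 0 < c / 2)]
    have : |α - 1 / 2| ≤ 1 / 2 := abs_le.mpr ⟨by linarith [hα.1], by linarith [hα.2]⟩
    nlinarith
  have h2 : Real.cosh (c / 2) ≤ 2 * Real.sinh (c / 2) := by
    have e1 : 2 ≤ Real.exp (c / 2) := by
      have := Real.add_one_le_exp (c / 2)
      linarith
    have e2 : Real.exp (c / 2) * Real.exp (-(c / 2)) = 1 := by rw [← Real.exp_add]; simp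
    have e3 : 0 < Real.exp (-(c / 2)) := Real.exp_pos _
    rw [Real.cosh_eq, Real.sinh_eq]
    nlinarith
  unfold expKernel
  rw [div_le_iff₀ hs]
  nlinarith

theorem hasDerivAt_expKernel (c α : ℝ) : HasDerivAt (expKernel c) (expKernelDeriv c α) α := by
  have h : HasDerivAt (fun α : ℝ => c * (α - 1 / 2)) c α := by
    simpa only [mul_one] using ((hasDerivAt_id' α).sub_const (1 / 2)).const_mul c
  convert! (h.cosh.const_mul (c / 2)).div_const (Real.sinh (c / 2)) using 1
  unfold expKernelDeriv
  ring

theorem hasDerivAt_expKernelDeriv (c α : ℝ) :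
    HasDerivAt (expKernelDeriv c) (c ^ 2 * expKernel c α) α := by
  have h : HasDerivAt (fun α : ℝ => c * (α - 1 / 2)) c α := by
    simpa only [mul_one] using ((hasDerivAt_id' α).sub_const (1 / 2)).const_mul c
  convert! (h.sinh.const_mul (c ^ 2 / 2)).div_const (Real.sinh (c / 2)) using 1
  unfold expKernel
  ring

theorem expKernelDeriv_zero {c : ℝ} (hc : 0 < c) : expKernelDeriv c 0 = -(c ^ 2 / 2) := by
  have := (Real.sinh_pos_iff.mpr (half_pos hc)).ne'
  unfold expKernelDeriv
  rw [show c * (0 - 1 / 2) = -(c / 2) by ring, Real.sinh_neg]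
  field_simp

theorem expKernelDeriv_one {c : ℝ} (hc : 0 < c) : expKernelDeriv c 1 = c ^ 2 / 2 := by
  have := (Real.sinh_pos_iff.mpr (half_pos hc)).ne'
  unfold expKernelDeriv
  rw [show c * (1 - 1 / 2) = c / 2 by ring]
  field_simp

theorem abs_expKernelDeriv_le {c : ℝ} (hc : 0 < c) {α : ℝ} (hα : α ∈ Set.Icc (0 : ℝ) 1) :
    |expKernelDeriv c α| ≤ c ^ 2 / 2 := by
  have hm : MonotoneOn (expKernelDeriv c) (Set.Icc 0 1) := by
    have hs := Real.sinh_pos_iff.mpr (half_pos hc)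
    intro a _ b _ hab
    unfold expKernelDeriv
    gcongr
    exact Real.sinh_le_sinh.mpr (by nlinarith)
  rw [abs_le, ← expKernelDeriv_zero hc, ← expKernelDeriv_one hc]
  exact ⟨hm (by simp) hα hα.1, hm hα (by simp) hα.2⟩

/-- Green's formula for the kernel, which solves `K'' = c² (K - δ)` on the circle. -/
theorem integral_expKernel_mul_sub {c : ℝ} (hc : 0 < c) {p p' p'' : ℝ → ℂ}
    (hp : ∀ x ∈ Set.Icc (0 : ℝ) 1, HasDerivAt p (p' x) x)
    (hp' : ∀ x ∈ Set.Icc (0 : ℝ) 1, HasDerivAt p' (p'' x) x)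
    (hcont : ContinuousOn p'' (Set.Icc 0 1)) :
    ∫ α in (0 : ℝ)..1, (expKernel c α : ℂ) * (c ^ 2 * p α - p'' α)
      = c ^ 2 * (p 0 + p 1) / 2 - expKernel c 0 * (p' 1 - p' 0) := by
  have hI : Set.uIcc (0 : ℝ) 1 = Set.Icc 0 1 := Set.uIcc_of_le zero_le_one
  have key := intervalIntegral.integral_eq_sub_of_hasDerivAt (a := 0) (b := 1)
    (f := fun x => (expKernelDeriv c x : ℂ) * p x - (expKernel c x : ℂ) * p' x)
    (f' := fun α => (expKernel c α : ℂ) * (c ^ 2 * p α - p'' α)) (fun x hx => ?_) ?_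
  · rw [key, expKernelDeriv_one hc, expKernelDeriv_zero hc, expKernel_one]
    push_cast
    ring
  · rw [hI] at hx
    convert! ((hasDerivAt_expKernelDeriv c x).ofReal_comp.mul (hp x hx)).sub
      ((hasDerivAt_expKernel c x).ofReal_comp.mul (hp' x hx)) using 1
    push_cast
    ring
  · refine ContinuousOn.intervalIntegrable ?_
    rw [hI]
    have h1 : ContinuousOn p (Set.Icc 0 1) := fun x hx => (hp x hx).continuousAt.continuousWithinAt
    have := (continuous_expKernel c).continuousOn (s := Set.Icc 0 1)
    fun_prop

theorem integral_expKernel {c : ℝ} (hc : 0 < c) : ∫ α in (0 : ℝ)..1, (expKernel c α : ℂ) = 1 := by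
  have h := integral_expKernel_mul_sub hc (p := fun _ => 1) (p' := fun _ => 0) (p'' := fun _ => 0)
    (fun x _ => hasDerivAt_const _ _) (fun x _ => hasDerivAt_const _ _) continuousOn_const
  have hc' : (c : ℂ) ^ 2 ≠ 0 := pow_ne_zero _ (ofReal_ne_zero.mpr hc.ne')
  simp only [mul_one, sub_zero, sub_self, mul_zero] at h
  rw [intervalIntegral.integral_mul_const] at h
  have : (c : ℂ) ^ 2 * (1 + 1) / 2 = c ^ 2 := by ring
  rw [this] at h
  exact (mul_eq_right₀ hc').mp h

theorem integral_expKernel_real {c : ℝ} (hc : 0 < c) : ∫ α in (0 : ℝ)..1, expKernel c α = 1 := by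
  have h := integral_expKernel hc
  rw [intervalIntegral.integral_ofReal] at h
  exact_mod_cast h

/-- The Fourier coefficients of `expKernel`. -/
noncomputable def expKernelCoeff (c : ℝ) (n : ℕ) : ℝ := c ^ 2 / (c ^ 2 + (2 * Real.pi * n) ^ 2)

/-- Green's formula applied to a character, which is an eigenfunction of the second derivative with
eigenvalue `-(2πn) ^ 2`; the numerator `c ^ 2` comes from the jump of the kernel's derivative at the
integers. -/
theorem integral_exp_mul_expKernel {c : ℝ} (hc : 0 < c) (n : ℤ) :
    ∫ α in (0 : ℝ)..1, (expKernel c α : ℂ) * cexp (2 * Real.pi * I * n * α)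
      = c ^ 2 / (c ^ 2 + (2 * Real.pi * n) ^ 2) := by
  set w : ℂ := 2 * Real.pi * I * n with hw
  have hd : ∀ (x : ℝ) (a : ℂ), HasDerivAt (fun x : ℝ => a * cexp (w * x)) (a * w * cexp (w * x)) x := by
    intro x a
    have := ((hasDerivAt_const_mul w (x := (x : ℂ))).cexp.const_mul a).comp_ofReal
    convert! this using 1
    ring
  have h := integral_expKernel_mul_sub hc (p := fun α : ℝ => 1 * cexp (w * α))
    (p' := fun α : ℝ => 1 * w * cexp (w * α)) (p'' := fun α : ℝ => 1 * w * w * cexp (w * α))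
    (fun x _ => hd x 1) (fun x _ => hd x (1 * w)) (by fun_prop)
  have e1 : cexp (w * (1 : ℝ)) = 1 := by
    rw [ofReal_one, mul_one, hw, show 2 * Real.pi * I * n = n * (2 * Real.pi * I) by ring]
    exact Complex.exp_int_mul_two_pi_mul_I n
  have hD : ((c : ℂ) ^ 2 + (2 * Real.pi * n) ^ 2) ≠ 0 := by
    exact_mod_cast (by positivity : c ^ 2 + (2 * Real.pi * n) ^ 2 ≠ 0)
  have e2 : (c : ℂ) ^ 2 + (2 * Real.pi * n) ^ 2 = c ^ 2 - w * w := by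
    rw [hw]
    linear_combination (2 * Real.pi * n) ^ 2 * I_sq
  rw [e1] at h
  simp only [ofReal_zero, mul_zero, Complex.exp_zero, sub_self, sub_zero, one_mul, mul_one] at h
  rw [eq_div_iff hD, e2, ← intervalIntegral.integral_mul_const]
  calc _ = ∫ α in (0 : ℝ)..1, (expKernel c α : ℂ) * (c ^ 2 * cexp (w * α) - w * w * cexp (w * α)) := by
        congr 1; ext α; ring
    _ = _ := by rw [h]; ring

theorem summable_expKernelCoeff (c : ℝ) : Summable (expKernelCoeff c) := by
  have h : Summable fun n : ℕ => c ^ 2 * (1 / (n : ℝ) ^ 2) :=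
    (Real.summable_one_div_nat_pow.mpr one_lt_two).mul_left _
  refine Summable.of_norm_bounded_eventually_nat h ?_
  filter_upwards [eventually_gt_atTop 0] with n hn
  have hn' : (0 : ℝ) < n := Nat.cast_pos.mpr hn
  have hpi := Real.pi_gt_three
  rw [Real.norm_of_nonneg (by unfold expKernelCoeff; positivity), expKernelCoeff, mul_one_div]
  gcongr
  have h1 : (n : ℝ) ^ 2 ≤ (2 * Real.pi * n) ^ 2 :=
    pow_le_pow_left₀ hn'.le (le_mul_of_one_le_left hn'.le (by linarith)) 2
  nlinarith [sq_nonneg c]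

theorem hasSum_expKernel {c : ℝ} (hc : 0 < c) {α : ℝ} (hα : α ∈ Set.Icc (0 : ℝ) 1) :
    HasSum (fun n : ℕ => (expKernelCoeff c (n + 1) : ℂ) *
      (2 * Complex.cos ((2 * Real.pi * (n + 1 : ℕ) * α : ℝ) : ℂ))) (expKernel c α - 1) := by
  -- The lift to the circle evaluates on `[0, 1)`, so the right end point is carried back to `0` by
  -- periodicity.
  wlog hlt : α < 1 generalizing α
  · have h1 : α = 1 := le_antisymm hα.2 (not_lt.mp hlt)
    have h0 := this (α := 0) (by simp) one_pos
    rw [h1, expKernel_one]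
    convert! h0 using 4 with n
    rw [mul_one, mul_zero, ofReal_zero, Complex.cos_zero]
    have := Complex.cos_nat_mul_two_pi (n + 1)
    rw [← this]
    push_cast
    ring_nf
  have : Fact ((0 : ℝ) < 1) := ⟨one_pos⟩
  let F : C(AddCircle (1 : ℝ), ℂ) := ⟨AddCircle.liftIco 1 0 fun α => (expKernel c α : ℂ),
    AddCircle.liftIco_zero_continuous (by rw [expKernel_one])
      (continuous_ofReal.comp (continuous_expKernel c)).continuousOn⟩
  have hF : ∀ n : ℤ, fourierCoeff F n = c ^ 2 / (c ^ 2 + (2 * Real.pi * n) ^ 2) := by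
    intro n
    have h := fourierCoeff_liftIco_eq (T := 1) (a := 0) (fun α => (expKernel c α : ℂ)) n
    rw [fourierCoeffOn_eq_integral] at h
    refine h.trans ?_
    rw [zero_add, sub_zero, div_one, one_smul]
    have h2 := integral_exp_mul_expKernel hc (-n)
    push_cast at h2
    rw [show (2 * (Real.pi : ℂ) * -n) ^ 2 = (2 * Real.pi * n) ^ 2 by ring] at h2
    rw [← h2]
    congr 1
    ext x
    rw [fourier_coe_apply, smul_eq_mul, mul_comm]
    push_cast
    rw [div_one]
  have hsum : Summable (fourierCoeff F) := by
    refine Summable.of_nat_of_neg ?_ ?_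
    · refine (summable_ofReal.mpr (summable_expKernelCoeff c)).congr fun n => ?_
      rw [hF]; unfold expKernelCoeff; push_cast; rfl
    · refine (summable_ofReal.mpr (summable_expKernelCoeff c)).congr fun n => ?_
      rw [hF]; unfold expKernelCoeff; push_cast; ring
  have h := (has_pointwise_sum_fourier_series_of_summable hsum (α : AddCircle (1 : ℝ))).nat_add_neg
  have hFα : F (α : AddCircle (1 : ℝ)) = expKernel c α :=
    AddCircle.liftIco_coe_apply (f := fun α => (expKernel c α : ℂ)) ⟨hα.1, by simpa using hlt⟩
  rw [hFα, hF] at h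
  -- Pairing `n` with `-n` counts `n = 0` twice. Removing that pair leaves the kernel minus its mean
  -- `1`.
  have h' := (hasSum_nat_add_iff' 1).mpr h
  have hc2 : (c : ℂ) ^ 2 ≠ 0 := pow_ne_zero _ (ofReal_ne_zero.mpr hc.ne')
  convert! h' using 1
  · ext n
    rw [hF, hF, fourier_coe_apply, fourier_coe_apply, Complex.cos]
    unfold expKernelCoeff
    push_cast
    rw [div_one, div_one, smul_eq_mul, smul_eq_mul]
    have e1 : 2 * (Real.pi : ℂ) * (n + 1) * α * I = 2 * Real.pi * I * (n + 1) * α := by ring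
    have e2 : -(2 * (Real.pi : ℂ) * (n + 1) * α) * I = 2 * Real.pi * I * (-1 + -n) * α := by ring
    rw [e1, e2]
    have e3 : (2 * (Real.pi : ℂ) * (-1 + -n)) ^ 2 = (2 * Real.pi * (n + 1)) ^ 2 := by ring
    have e4 : -((n : ℂ) + 1) = -1 + -n := by ring
    simp only [e3, e4]
    ring
  · simp [hF, hc2]

/-! ### Approximate resolvent of `x ^ (-s)` and the kernel average over `[1, N + 1]`. -/

theorem hasDerivAt_inv_add_sq {Y : ℝ} (hY : 0 < Y) (x : ℝ) :
    HasDerivAt (fun x : ℝ => (((Y + x ^ 2)⁻¹ : ℝ) : ℂ)) (-2 * x * ((Y + x ^ 2)⁻¹ : ℝ) ^ 2) x := by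
  have h1 : HasDerivAt (fun x : ℝ => Y + x ^ 2) (2 * x) x := by
    simpa using (hasDerivAt_pow 2 x).const_add Y
  have h2 := (h1.fun_inv (by positivity : Y + x ^ 2 ≠ 0)).ofReal_comp
  convert! h2 using 1
  push_cast
  rw [div_eq_mul_inv, inv_pow]
  ring

theorem hasDerivAt_cpow_neg_mul_pow {s : ℂ} (hs : s ≠ 0) {x : ℝ} (hx : 0 < x) (k : ℕ) :
    HasDerivAt (fun x : ℝ => (x : ℂ) ^ (-s) * (x : ℂ) ^ (k + 1))
      ((k + 1 - s) * ((x : ℂ) ^ (-s) * (x : ℂ) ^ k)) x := by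
  have hx' : (x : ℂ) ≠ 0 := ofReal_ne_zero.mpr hx.ne'
  have h := (hasDerivAt_cpow_neg_ofReal hs hx).mul
    (((hasDerivAt_pow (k + 1) (x : ℂ))).comp_ofReal)
  convert! h using 1
  rw [cpow_sub _ _ hx', cpow_one, pow_succ, add_tsub_cancel_right]
  push_cast
  field_simp
  ring

/-- The term `x ^ (2 - s) / (Y + x ^ 2)` of the smoothed zeta sum. -/
noncomputable def cutoffTerm (Y : ℝ) (s : ℂ) (x : ℝ) : ℂ :=
  (x : ℂ) ^ (-s) * (x : ℂ) ^ 2 * ((Y + x ^ 2)⁻¹ : ℝ)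

noncomputable def cutoffTermDeriv (Y : ℝ) (s : ℂ) (x : ℝ) : ℂ :=
  (2 - s) * ((x : ℂ) ^ (-s) * (x : ℂ) ^ 1 * ((Y + x ^ 2)⁻¹ : ℝ))
    - 2 * ((x : ℂ) ^ (-s) * (x : ℂ) ^ 3 * ((Y + x ^ 2)⁻¹ : ℝ) ^ 2)

noncomputable def cutoffTermDerivTwo (Y : ℝ) (s : ℂ) (x : ℝ) : ℂ :=
  (x : ℂ) ^ (-s) * ((1 - s) * (2 - s) * ((Y + x ^ 2)⁻¹ : ℝ)
    + (4 * s - 10) * (x : ℂ) ^ 2 * ((Y + x ^ 2)⁻¹ : ℝ) ^ 2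
    + 8 * (x : ℂ) ^ 4 * ((Y + x ^ 2)⁻¹ : ℝ) ^ 3)

theorem hasDerivAt_cutoffTerm {Y : ℝ} (hY : 0 < Y) {s : ℂ} (hs : s ≠ 0) {x : ℝ} (hx : 0 < x) :
    HasDerivAt (cutoffTerm Y s) (cutoffTermDeriv Y s x) x := by
  convert! (hasDerivAt_cpow_neg_mul_pow hs hx 1).mul (hasDerivAt_inv_add_sq hY x) using 1
  unfold cutoffTermDeriv
  push_cast
  ring

theorem hasDerivAt_cutoffTermDeriv {Y : ℝ} (hY : 0 < Y) {s : ℂ} (hs : s ≠ 0) {x : ℝ} (hx : 0 < x) :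
    HasDerivAt (cutoffTermDeriv Y s) (cutoffTermDerivTwo Y s x) x := by
  have hq := hasDerivAt_inv_add_sq hY x
  convert! (((hasDerivAt_cpow_neg_mul_pow hs hx 0).mul hq).const_mul (2 - s)).sub
    (((hasDerivAt_cpow_neg_mul_pow hs hx 2).mul (hq.pow 2)).const_mul 2) using 1
  unfold cutoffTermDerivTwo
  push_cast
  simp only [Pi.pow_apply]
  ring

theorem continuousOn_cutoffTermDerivTwo {Y : ℝ} (hY : 0 < Y) (s : ℂ) :
    ContinuousOn (cutoffTermDerivTwo Y s) (Set.Ioi 0) := by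
  unfold cutoffTermDerivTwo
  have hq : Continuous fun x : ℝ => (((Y + x ^ 2)⁻¹ : ℝ) : ℂ) :=
    continuous_ofReal.comp (Continuous.inv₀ (by fun_prop) fun x => by positivity)
  exact (continuousOn_ofReal_cpow (-s)).mul (Continuous.continuousOn (by fun_prop))

theorem norm_cpow_neg_le_one {s : ℂ} (hs : 0 ≤ s.re) {x : ℝ} (hx : 1 ≤ x) :
    ‖(x : ℂ) ^ (-s)‖ ≤ 1 := by
  rw [norm_cpow_eq_rpow_re_of_pos (by linarith)]
  exact Real.rpow_le_one_of_one_le_of_nonpos hx (by simpa using hs)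

theorem norm_cutoffTerm_le_one {Y : ℝ} (hY : 0 < Y) {s : ℂ} (hs : 0 ≤ s.re) {x : ℝ} (hx : 1 ≤ x) :
    ‖cutoffTerm Y s x‖ ≤ 1 := by
  unfold cutoffTerm
  rw [mul_assoc, norm_mul]
  refine mul_le_one₀ (norm_cpow_neg_le_one hs hx) (norm_nonneg _) ?_
  rw [← ofReal_pow, ← ofReal_mul, norm_real, Real.norm_of_nonneg (by positivity),
    ← div_eq_mul_inv, div_le_one (by positivity)]
  linarith

/-- The factor `1 / (2X)` is `2Xx ≤ X ^ 2 + x ^ 2`. In the application `c = 2πX`, so multiplying by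
the kernel's value at `0`, at most `c`, leaves boundary terms of order `1 + ‖s‖`, hence `O(c ^ 2)`.
-/
theorem norm_cutoffTermDeriv_le {X : ℝ} (hX : 0 < X) {s : ℂ} (hs : 0 ≤ s.re) {x : ℝ} (hx : 1 ≤ x) :
    ‖cutoffTermDeriv (X ^ 2) s x‖ ≤ (4 + ‖s‖) / (2 * X) := by
  set q : ℝ := (X ^ 2 + x ^ 2)⁻¹ with hq
  have hq0 : 0 < q := by positivity
  have hx0 : 0 < x := by linarith
  have hxq : x * q ≤ 1 / (2 * X) := by
    rw [hq, ← div_eq_mul_inv, div_le_div_iff₀ (by positivity) (by positivity)]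
    nlinarith [sq_nonneg (X - x)]
  have hu : x ^ 2 * q ≤ 1 := by
    rw [hq, ← div_eq_mul_inv, div_le_one (by positivity)]
    nlinarith [sq_nonneg X]
  have e : cutoffTermDeriv (X ^ 2) s x
      = (x : ℂ) ^ (-s) * (((x * q : ℝ) : ℂ) * (2 - s - 2 * ((x ^ 2 * q : ℝ) : ℂ))) := by
    unfold cutoffTermDeriv
    rw [← hq]
    push_cast
    ring
  rw [e, norm_mul, norm_mul, norm_real, Real.norm_of_nonneg (by positivity)]
  have h1 : ‖2 - s - 2 * ((x ^ 2 * q : ℝ) : ℂ)‖ ≤ 4 + ‖s‖ := by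
    refine (norm_sub_le _ _).trans ?_
    have h2 : ‖(2 : ℂ) * ((x ^ 2 * q : ℝ) : ℂ)‖ ≤ 2 := by
      rw [norm_mul, norm_real, Real.norm_of_nonneg (by positivity), norm_ofNat]
      linarith
    have h3 : ‖2 - s‖ ≤ 2 + ‖s‖ := by simpa using norm_sub_le (2 : ℂ) s
    linarith
  calc _ ≤ 1 * (1 / (2 * X) * (4 + ‖s‖)) := by
        gcongr
        exact norm_cpow_neg_le_one hs hx
    _ = _ := by ring

/-- `cutoffTerm` solves the resolvent equation `p - p'' / c ^ 2 = x ^ (-s)` up to a small error. -/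
theorem norm_cutoffTerm_resolvent_le {c t : ℝ} (ht : 1 ≤ t) (hc : c ^ 2 = 2 * Real.pi * t) {x : ℝ}
    (hx : 1 ≤ x) :
    ‖(c : ℂ) ^ 2 * cutoffTerm ((c / (2 * Real.pi)) ^ 2) (1 / 2 + t * I) x
      - cutoffTermDerivTwo ((c / (2 * Real.pi)) ^ 2) (1 / 2 + t * I) x
      - c ^ 2 * (x : ℂ) ^ (-(1 / 2 + t * I))‖ ≤ 27 * t / x ^ 2 := by
  have hpi := Real.pi_pos
  have hx0 : 0 < x := by linarith
  set s : ℂ := 1 / 2 + t * I with hs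
  set Y : ℝ := (c / (2 * Real.pi)) ^ 2 with hY
  have hcY : c ^ 2 * Y = t ^ 2 := by
    rw [hY, div_pow, hc]; field_simp
  have hY0 : 0 ≤ Y := sq_nonneg _
  set q : ℝ := (Y + x ^ 2)⁻¹ with hq
  have hq0 : 0 < q := by positivity
  have hqY : q * (Y + x ^ 2) = 1 := inv_mul_cancel₀ (by positivity)
  have hu : x ^ 2 * q ≤ 1 := by nlinarith
  have hqx : q ≤ 1 / x ^ 2 := by rw [le_div_iff₀ (by positivity)]; linarith
  -- The leading terms cancel: `(1 - s)(2 - s)` contributes `-t ^ 2` and `c ^ 2 Y = t ^ 2`, so they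
  -- form `c ^ 2 q (x ^ 2 + Y) = c ^ 2`. What is left carries the factor `q ≤ 1 / x ^ 2` and grows
  -- only linearly in `t`.
  have e : (c : ℂ) ^ 2 * cutoffTerm Y s x - cutoffTermDerivTwo Y s x - c ^ 2 * (x : ℂ) ^ (-s)
      = -((x : ℂ) ^ (-s) * ((q : ℂ) * (3 / 4 - 2 * t * I + (4 * s - 10) * ((x ^ 2 * q : ℝ) : ℂ)
        + 8 * ((x ^ 2 * q : ℝ) : ℂ) ^ 2))) := by
    have h1 : (c : ℂ) ^ 2 * Y = t ^ 2 := by exact_mod_cast hcY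
    have h2 : (q : ℂ) * (Y + x ^ 2) = 1 := by exact_mod_cast hqY
    have h3 : (1 - s) * (2 - s) = 3 / 4 - 2 * t * I - t ^ 2 := by
      rw [hs]; linear_combination (t : ℂ) ^ 2 * I_sq
    unfold cutoffTerm cutoffTermDerivTwo
    rw [← hq, h3]
    push_cast
    linear_combination (-(x : ℂ) ^ (-s) * q) * h1 + (c : ℂ) ^ 2 * (x : ℂ) ^ (-s) * h2
  rw [e, norm_neg, norm_mul, norm_mul, norm_real, Real.norm_of_nonneg hq0.le]
  have hre : s.re = 1 / 2 := by simp [hs]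
  have hsn : ‖s‖ ≤ 1 / 2 + t := by
    rw [hs]
    refine (norm_add_le _ _).trans ?_
    rw [norm_mul, norm_I, norm_real, Real.norm_of_nonneg (by linarith)]
    norm_num
  have hu' : ‖((x ^ 2 * q : ℝ) : ℂ)‖ ≤ 1 := by
    rw [norm_real, Real.norm_of_nonneg (by positivity)]; exact hu
  -- The three bounds add up to `20.75 + 6t`, at most `27t` because `t ≥ 1`.
  have hb : ‖(3 / 4 - 2 * t * I + (4 * s - 10) * ((x ^ 2 * q : ℝ) : ℂ)
        + 8 * ((x ^ 2 * q : ℝ) : ℂ) ^ 2)‖ ≤ 27 * t := by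
    have b1 : ‖(3 / 4 - 2 * t * I : ℂ)‖ ≤ 3 / 4 + 2 * t := by
      refine (norm_sub_le _ _).trans ?_
      rw [norm_mul, norm_mul, norm_I, norm_real, Real.norm_of_nonneg (by linarith)]
      norm_num
    have b2 : ‖(4 * s - 10) * ((x ^ 2 * q : ℝ) : ℂ)‖ ≤ (4 * ‖s‖ + 10) * 1 := by
      rw [norm_mul]
      gcongr
      simpa using norm_sub_le (4 * s) 10
    have b3 : ‖8 * ((x ^ 2 * q : ℝ) : ℂ) ^ 2‖ ≤ 8 * 1 := by
      rw [norm_mul, norm_pow, norm_ofNat]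
      gcongr
      exact pow_le_one₀ (norm_nonneg _) hu'
    refine (norm_add_le _ _).trans ?_
    have := norm_add_le (3 / 4 - 2 * t * I : ℂ) ((4 * s - 10) * ((x ^ 2 * q : ℝ) : ℂ))
    linarith
  calc _ ≤ 1 * (1 / x ^ 2 * (27 * t)) := by
        gcongr
        exact norm_cpow_neg_le_one (by rw [hre]; norm_num) hx
    _ = _ := by ring

theorem sum_one_div_sq_le_two (N : ℕ) :
    ∑ n ∈ Finset.range N, 1 / ((n : ℝ) + 1) ^ 2 ≤ 2 := by
  have h : ∑ n ∈ Finset.range N, 1 / ((n : ℝ) + 1) ^ 2 ≤ 2 - 2 / ((N : ℝ) + 1) := by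
    induction N with
    | zero => simp
    | succ N ih =>
      rw [Finset.sum_range_succ]
      push_cast
      have : 1 / ((N : ℝ) + 1) ^ 2 ≤ 2 / ((N : ℝ) + 1) - 2 / ((N : ℝ) + 1 + 1) := by
        rw [div_sub_div _ _ (by positivity) (by positivity), div_le_div_iff₀ (by positivity)
          (by positivity)]
        nlinarith [(Nat.cast_nonneg N : (0 : ℝ) ≤ N), sq_nonneg ((N : ℝ) + 1)]
      linarith
  have : 0 ≤ 2 / ((N : ℝ) + 1) := by positivity
  linarith

theorem norm_one_half_add_mul_I_le {t : ℝ} (ht : 0 ≤ t) : ‖(1 / 2 + t * I : ℂ)‖ ≤ 1 / 2 + t := by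
  refine (norm_add_le _ _).trans ?_
  rw [norm_mul, norm_I, norm_real, Real.norm_of_nonneg ht]
  norm_num

/-- Summing the Green formula over the unit intervals of `[1, N + 1]`. -/
theorem norm_sum_integral_expKernel_sub_le {c t : ℝ} (ht : 1 ≤ t) (hc2 : 2 ≤ c)
    (hc : c ^ 2 = 2 * Real.pi * t) (N : ℕ) :
    ‖∑ n ∈ Finset.range N, (∫ α in (0 : ℝ)..1,
        (expKernel c α : ℂ) * ((n + 1 + α : ℝ) : ℂ) ^ (-(1 / 2 + t * I)))
      - ∑ n ∈ Finset.range N, cutoffTerm ((c / (2 * Real.pi)) ^ 2) (1 / 2 + t * I) (n + 1)‖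
      ≤ 20 := by
  have hpi := Real.pi_gt_three
  have hc0 : 0 < c := by linarith
  have hX : 0 < c / (2 * Real.pi) := by positivity
  set X : ℝ := c / (2 * Real.pi) with hXd
  set s : ℂ := 1 / 2 + t * I with hs
  have hre : s.re = 1 / 2 := by simp [hs]
  have hre0 : 0 ≤ s.re := by rw [hre]; norm_num
  have hs0 : s ≠ 0 := by
    intro h
    rw [h] at hre
    norm_num at hre
  have hsn : ‖s‖ ≤ 1 / 2 + t := norm_one_half_add_mul_I_le (by linarith)
  have hY : 0 < X ^ 2 := by positivity
  set E : ℝ → ℂ := fun x => (c : ℂ) ^ 2 * cutoffTerm (X ^ 2) s x - cutoffTermDerivTwo (X ^ 2) s x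
      - c ^ 2 * (x : ℂ) ^ (-s) with hE
  have hEb : ∀ x : ℝ, 1 ≤ x → ‖E x‖ ≤ 27 * t / x ^ 2 := fun x hx =>
    norm_cutoffTerm_resolvent_le ht hc hx
  have hEc : ContinuousOn E (Set.Ioi 0) := by
    refine (ContinuousOn.sub (continuousOn_const.mul fun x hx =>
      (hasDerivAt_cutoffTerm hY hs0 hx).continuousAt.continuousWithinAt)
      (continuousOn_cutoffTermDerivTwo hY s)).sub
      (continuousOn_const.mul (continuousOn_ofReal_cpow (-s)))
  have hK : Continuous fun α : ℝ => (expKernel c α : ℂ) :=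
    continuous_ofReal.comp (continuous_expKernel c)
  have hpos : ∀ (n : ℕ) (α : ℝ), α ∈ Set.Icc (0 : ℝ) 1 → (0 : ℝ) < n + 1 + α := fun n α hα => by
    have := hα.1; positivity
  have hI : Set.uIcc (0 : ℝ) 1 = Set.Icc 0 1 := Set.uIcc_of_le zero_le_one
  have hcont : ∀ (n : ℕ) (g : ℝ → ℂ), ContinuousOn g (Set.Ioi 0) → IntervalIntegrable
      (fun α : ℝ => (expKernel c α : ℂ) * g (n + 1 + α)) MeasureTheory.volume 0 1 := by
    intro n g hg
    refine (hK.continuousOn.mul (hg.comp (by fun_prop) fun α hα => ?_)).intervalIntegrable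
    rw [hI] at hα
    exact hpos n α hα
  have step : ∀ n : ℕ, (c : ℂ) ^ 2 * (∫ α in (0 : ℝ)..1,
        (expKernel c α : ℂ) * ((n + 1 + α : ℝ) : ℂ) ^ (-s))
      = c ^ 2 * (cutoffTerm (X ^ 2) s (n + 1) + cutoffTerm (X ^ 2) s (n + 1 + 1)) / 2
        - expKernel c 0 * (cutoffTermDeriv (X ^ 2) s (n + 1 + 1) - cutoffTermDeriv (X ^ 2) s (n + 1))
        - ∫ α in (0 : ℝ)..1, (expKernel c α : ℂ) * E (n + 1 + α) := by
    intro n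
    have h := integral_expKernel_mul_sub hc0 (p := fun α => cutoffTerm (X ^ 2) s (n + 1 + α))
      (p' := fun α => cutoffTermDeriv (X ^ 2) s (n + 1 + α))
      (p'' := fun α => cutoffTermDerivTwo (X ^ 2) s (n + 1 + α))
      (fun x hx => (hasDerivAt_cutoffTerm hY hs0 (hpos n x hx)).comp_const_add _ _)
      (fun x hx => (hasDerivAt_cutoffTermDeriv hY hs0 (hpos n x hx)).comp_const_add _ _)
      ((continuousOn_cutoffTermDerivTwo hY s).comp (by fun_prop) fun x hx => hpos n x hx)
    simp only [add_zero] at h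
    rw [← h, ← intervalIntegral.integral_const_mul, eq_sub_iff_add_eq,
      ← intervalIntegral.integral_add ((hcont n _ (continuousOn_ofReal_cpow (-s))).const_mul _)
        (hcont n E hEc)]
    congr 1
    ext α
    simp only [hE]
    ring
  -- Green's formula yields trapezoidal half-sums; their differences from the left end values
  -- telescope, and so do the derivative terms, as the kernel takes equal values at `0` and `1`.
  have tel : ∀ N : ℕ, (c : ℂ) ^ 2 * (∑ n ∈ Finset.range N, (∫ α in (0 : ℝ)..1,
        (expKernel c α : ℂ) * ((n + 1 + α : ℝ) : ℂ) ^ (-s))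
        - ∑ n ∈ Finset.range N, cutoffTerm (X ^ 2) s (n + 1))
      = c ^ 2 * (cutoffTerm (X ^ 2) s (N + 1) - cutoffTerm (X ^ 2) s 1) / 2
        - expKernel c 0 * (cutoffTermDeriv (X ^ 2) s (N + 1) - cutoffTermDeriv (X ^ 2) s 1)
        - ∑ n ∈ Finset.range N, ∫ α in (0 : ℝ)..1, (expKernel c α : ℂ) * E (n + 1 + α) := by
    intro N
    induction N with
    | zero => simp
    | succ N ih =>
      rw [Finset.sum_range_succ, Finset.sum_range_succ, Finset.sum_range_succ]
      rw [show ((N + 1 : ℕ) : ℝ) = N + 1 from Nat.cast_succ N]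
      linear_combination ih + step N
  have herr : ‖∑ n ∈ Finset.range N, ∫ α in (0 : ℝ)..1, (expKernel c α : ℂ) * E (n + 1 + α)‖
      ≤ 54 * t := by
    have h1 : ∀ n : ℕ, ‖∫ α in (0 : ℝ)..1, (expKernel c α : ℂ) * E (n + 1 + α)‖
        ≤ 27 * t * (1 / ((n : ℝ) + 1) ^ 2) := by
      intro n
      have hn : (1 : ℝ) ≤ n + 1 := by simp
      calc _ ≤ ∫ α in (0 : ℝ)..1, expKernel c α * (27 * t * (1 / ((n : ℝ) + 1) ^ 2)) := by
            refine intervalIntegral.norm_integral_le_of_norm_le zero_le_one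
              (Eventually.of_forall fun α hα => ?_)
              (((continuous_expKernel c).mul continuous_const).intervalIntegrable _ _)
            have h0 := expKernel_nonneg hc0 α
            rw [norm_mul, norm_real, Real.norm_of_nonneg h0]
            refine mul_le_mul_of_nonneg_left ((hEb _ (by linarith [hα.1])).trans ?_) h0
            rw [mul_one_div]
            exact div_le_div_of_nonneg_left (by linarith) (by positivity)
              (pow_le_pow_left₀ (by positivity) (by linarith [hα.1]) 2)
        _ = _ := by rw [intervalIntegral.integral_mul_const, integral_expKernel_real hc0, one_mul]
    refine (norm_sum_le _ _).trans ((Finset.sum_le_sum fun n _ => h1 n).trans ?_)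
    rw [← Finset.mul_sum]
    nlinarith [sum_one_div_sq_le_two N]
  have hK0 : ‖(expKernel c 0 : ℂ)‖ ≤ c := by
    rw [norm_real, Real.norm_of_nonneg (expKernel_nonneg hc0 0)]
    exact expKernel_le hc2 (by simp)
  have hN1 : (1 : ℝ) ≤ N + 1 := by simp
  have hp1 := norm_cutoffTerm_le_one hY hre0 hN1
  have hp2 := norm_cutoffTerm_le_one hY hre0 le_rfl
  have hd1 := norm_cutoffTermDeriv_le hX hre0 hN1
  have hd2 := norm_cutoffTermDeriv_le hX hre0 le_rfl
  have hD : (4 + ‖s‖) / (2 * X) * c ≤ Real.pi * (5 + t) := by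
    rw [hXd, div_mul_eq_mul_div, div_le_iff₀ (by positivity)]
    have : Real.pi * (5 + t) * (2 * (c / (2 * Real.pi))) = (5 + t) * c := by field_simp
    rw [this]
    exact mul_le_mul_of_nonneg_right (by linarith) hc0.le
  have hmain : c ^ 2 * ‖∑ n ∈ Finset.range N, (∫ α in (0 : ℝ)..1,
        (expKernel c α : ℂ) * ((n + 1 + α : ℝ) : ℂ) ^ (-s))
        - ∑ n ∈ Finset.range N, cutoffTerm (X ^ 2) s (n + 1)‖
      ≤ c ^ 2 * 1 + 2 * (Real.pi * (5 + t)) + 54 * t := by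
    have hcn : ‖(c : ℂ) ^ 2‖ = c ^ 2 := by
      rw [norm_pow, norm_real, Real.norm_of_nonneg hc0.le]
    rw [← hcn, ← norm_mul, tel N]
    refine (norm_sub_le _ _).trans (add_le_add ((norm_sub_le _ _).trans (add_le_add ?_ ?_)) herr)
    · rw [mul_div_assoc, norm_mul]
      gcongr
      rw [norm_div, norm_ofNat, div_le_one two_pos]
      exact (norm_sub_le _ _).trans (by linarith)
    · rw [norm_mul]
      calc _ ≤ c * (2 * ((4 + ‖s‖) / (2 * X))) := by
            gcongr
            exact (norm_sub_le _ _).trans (by linarith)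
        _ ≤ _ := by linarith
  -- As `t ≥ 1` and `π > 3`, the three terms are at most `c ^ 2`, `6 c ^ 2` and `9 c ^ 2`.
  have hfin : c ^ 2 * 1 + 2 * (Real.pi * (5 + t)) + 54 * t ≤ c ^ 2 * 20 := by
    rw [hc]
    nlinarith
  exact le_of_mul_le_mul_left (hmain.trans hfin) (by positivity)

/-! ### Passage to the limit, and the smoothed zeta sum. -/

theorem tendsto_sum_cpow_sub {s : ℂ} (hs : 0 < s.re) (hs' : 0 < s.im) {α : ℝ}
    (hα : α ∈ Set.Icc (0 : ℝ) 1) :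
    Tendsto (fun N : ℕ => ∑ n ∈ Finset.range N, ((n + 1 + α : ℝ) : ℂ) ^ (-s)
      - ((N + 1 : ℝ) : ℂ) ^ (1 - s) / (1 - s)) atTop (nhds (modifiedHurwitzZeta s α)) := by
  have hs1 : s ≠ 1 := by rintro rfl; simp at hs'
  have h1 := (Summable.of_norm_bounded ((summable_nat_add_one_rpow hs).mul_left ‖s‖)
      (norm_hurwitzDefect_le hs1 hs hα)).hasSum.tendsto_sum_nat.const_add (1 / (s - 1))
  rw [← modifiedHurwitzZeta_eq_tsum hs hs' hα] at h1
  refine h1.congr fun N => ?_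
  rw [sum_hurwitzDefect]
  have : s - 1 ≠ 0 := sub_ne_zero.mpr hs1
  have : 1 - s ≠ 0 := sub_ne_zero.mpr hs1.symm
  have : 1 / (s - 1) = - (1 / (1 - s)) := by
    field_simp
    ring
  rw [this]
  ring

theorem modifiedHurwitzZeta_zero {s : ℂ} : modifiedHurwitzZeta s 0 = riemannZeta s := by
  simp [modifiedHurwitzZeta, HurwitzZeta.hurwitzZeta_zero]

/-- The partial integrals are `∫ x ^ (-s)` over `[1, N + 1]`, whose upper end term is exactly the
counterterm; the approximating sequence is constant. -/
theorem integral_modifiedHurwitzZeta {s : ℂ} (hs : 0 < s.re) (hs' : 0 < s.im) :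
    ∫ α in (0 : ℝ)..1, modifiedHurwitzZeta s α = -(1 / (1 - s)) := by
  have h := tendsto_integral_mul_modifiedHurwitzZeta hs hs' (φ := fun _ => 1) continuous_const
  simp only [one_mul] at h
  have hs1 : s ≠ 1 := by rintro rfl; simp at hs'
  refine tendsto_nhds_unique h (tendsto_const_nhds.congr fun N => ?_)
  have h0 := sum_integral_cos_mul_cpow s 0 N
  simp only [Nat.cast_zero, mul_zero, zero_mul, ofReal_zero, Complex.cos_zero, one_mul, mul_one] at h0
  rw [h0, integral_cpow (Or.inr ⟨by simpa using hs1, ?_⟩)]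
  · rw [show -s + 1 = 1 - s by ring]
    simp
    ring
  · rw [Set.uIcc_of_le (by simp)]
    exact fun h => by linarith [h.1]

/-- One integration by parts: `x ^ (1 - s)` vanishes at `0` and is at most `1` in modulus on `[0,
1]`. The gain `1 / ‖1 - s‖` makes the removed term `α ^ (-s)` negligible. -/
theorem norm_integral_mul_cpow_neg_le {s : ℂ} (hs : s.re < 1) {φ φ' : ℝ → ℂ} {B : ℝ}
    (hφ : ∀ x, HasDerivAt φ (φ' x) x) (hφ' : Continuous φ')
    (hB : ∀ x ∈ Set.Icc (0 : ℝ) 1, ‖φ' x‖ ≤ B) :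
    ‖∫ x in (0 : ℝ)..1, φ x * (x : ℂ) ^ (-s)‖ ≤ (‖φ 1‖ + B) / ‖1 - s‖ := by
  have hs1 : 1 - s ≠ 0 := by
    intro h
    have := congrArg re h
    simp at this
    linarith
  have hre : 0 < (1 - s).re := by simpa using hs
  have hφc : Continuous φ := continuous_iff_continuousAt.mpr fun x => (hφ x).continuousAt
  have hv : Continuous fun x : ℝ => (x : ℂ) ^ (1 - s) := continuous_ofReal_cpow_const hre
  have i1 : IntervalIntegrable (fun x : ℝ => φ' x * (x : ℂ) ^ (1 - s)) MeasureTheory.volume 0 1 :=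
    (hφ'.mul hv).intervalIntegrable _ _
  have i2 : IntervalIntegrable (fun x : ℝ => φ x * (x : ℂ) ^ (-s)) MeasureTheory.volume 0 1 :=
    (intervalIntegral.intervalIntegrable_cpow' (by simpa using hs)).continuousOn_mul
      hφc.continuousOn
  have key := intervalIntegral.integral_eq_sub_of_hasDeriv_right_of_le (a := 0) (b := 1)
    (f := fun x : ℝ => φ x * (x : ℂ) ^ (1 - s))
    (f' := fun x : ℝ => φ' x * (x : ℂ) ^ (1 - s) + (1 - s) * (φ x * (x : ℂ) ^ (-s)))
    zero_le_one (hφc.mul hv).continuousOn (fun x hx => by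
      have h := (hφ x).mul (hasDerivAt_ofReal_cpow_const hx.1.ne' hs1)
      rw [sub_sub_cancel_left] at h
      convert! h.hasDerivWithinAt using 1
      ring) (i1.add (i2.const_mul _))
  rw [intervalIntegral.integral_add i1 (i2.const_mul _), intervalIntegral.integral_const_mul] at key
  simp only [ofReal_one, one_cpow, mul_one, ofReal_zero, zero_cpow hs1, mul_zero, sub_zero] at key
  have hb : ‖∫ x in (0 : ℝ)..1, φ' x * (x : ℂ) ^ (1 - s)‖ ≤ B := by
    have := intervalIntegral.norm_integral_le_of_norm_le_const (a := (0 : ℝ)) (b := 1) (C := B)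
      (f := fun x : ℝ => φ' x * (x : ℂ) ^ (1 - s)) (fun x hx => by
        rw [Set.uIoc_of_le zero_le_one] at hx
        rw [norm_mul, norm_cpow_eq_rpow_re_of_pos hx.1]
        exact (mul_le_of_le_one_right (norm_nonneg _)
          (Real.rpow_le_one hx.1.le hx.2 hre.le)).trans (hB x ⟨hx.1.le, hx.2⟩))
    simpa using this
  rw [le_div_iff₀ (norm_pos_iff.mpr hs1), mul_comm, ← norm_mul, eq_sub_iff_add_eq'.mpr key]
  exact (norm_sub_le _ _).trans (by linarith)

/-- The smoothed dual sum `∑ n ^ (-s) / (1 + (2πn / c) ^ 2)`. -/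
noncomputable def smoothedZeta (c : ℝ) (s : ℂ) : ℂ :=
  ∑' n : ℕ, ((n + 1 : ℝ) : ℂ) ^ (-s) * (expKernelCoeff c (n + 1) : ℂ)

theorem expKernelCoeff_nonneg (c : ℝ) (n : ℕ) : 0 ≤ expKernelCoeff c n := by
  unfold expKernelCoeff; positivity

theorem hasSum_smoothedZeta (c : ℝ) {s : ℂ} (hs : 0 ≤ s.re) :
    HasSum (fun n : ℕ => ((n + 1 : ℝ) : ℂ) ^ (-s) * (expKernelCoeff c (n + 1) : ℂ))
      (smoothedZeta c s) := by
  refine (Summable.of_norm_bounded ((summable_nat_add_iff 1).mpr (summable_expKernelCoeff c))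
    fun n => ?_).hasSum
  rw [norm_mul, norm_real, Real.norm_of_nonneg (expKernelCoeff_nonneg _ _)]
  exact mul_le_of_le_one_left (expKernelCoeff_nonneg _ _) (norm_cpow_neg_le_one hs (by simp))

/-- Integrating `ζ₁(s, ·)` against the kernel gives `ζ(s)` minus the smoothed sum, up to `O(1)`. -/
theorem norm_integral_expKernel_mul_sub_le {c t : ℝ} (ht : 1 ≤ t) (hc2 : 2 ≤ c)
    (hc : c ^ 2 = 2 * Real.pi * t) :
    ‖(∫ α in (0 : ℝ)..1, (expKernel c α : ℂ) * modifiedHurwitzZeta (1 / 2 + t * I) α)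
      - (riemannZeta (1 / 2 + t * I) - smoothedZeta c (1 / 2 + t * I))‖ ≤ 20 := by
  have hpi := Real.pi_pos
  have hre : (1 / 2 + t * I : ℂ).re = 1 / 2 := by simp
  have hre0 : 0 < (1 / 2 + t * I : ℂ).re := by rw [hre]; norm_num
  have him : 0 < (1 / 2 + t * I : ℂ).im := by simp; linarith
  have hb := norm_sum_integral_expKernel_sub_le ht hc2 hc
  set s : ℂ := 1 / 2 + t * I with hs
  have h1 := tendsto_integral_mul_modifiedHurwitzZeta hre0 him
    (continuous_ofReal.comp (continuous_expKernel c))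
  simp only [Function.comp_apply] at h1
  rw [integral_expKernel (by linarith)] at h1
  have h2 := tendsto_sum_cpow_sub hre0 him (α := 0) (by simp)
  rw [modifiedHurwitzZeta_zero] at h2
  have h3 := (hasSum_smoothedZeta c hre0.le).tendsto_sum_nat
  refine le_of_tendsto (h1.sub (h2.sub h3)).norm (Eventually.of_forall fun N => ?_)
  refine le_of_eq_of_le (congrArg norm ?_) (hb N)
  -- With `Y = (c / 2π) ^ 2` the cutoff weight at an integer is exactly one minus the kernel's
  -- Fourier coefficient.
  have h4 : ∀ n : ℕ, cutoffTerm ((c / (2 * Real.pi)) ^ 2) s (n + 1)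
      = ((n + 1 + 0 : ℝ) : ℂ) ^ (-s)
        - ((n + 1 : ℝ) : ℂ) ^ (-s) * (expKernelCoeff c (n + 1) : ℂ) := by
    intro n
    have hr : ((n + 1 : ℝ) ^ 2 * ((c / (2 * Real.pi)) ^ 2 + (n + 1 : ℝ) ^ 2)⁻¹)
        = 1 - expKernelCoeff c (n + 1) := by
      unfold expKernelCoeff
      push_cast
      field_simp
      ring
    have hr' : (((n + 1 : ℝ) : ℂ) ^ 2 * (((c / (2 * Real.pi)) ^ 2 + (n + 1 : ℝ) ^ 2)⁻¹ : ℝ))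
        = 1 - expKernelCoeff c (n + 1) := by exact_mod_cast hr
    unfold cutoffTerm
    rw [mul_assoc, hr', add_zero]
    ring
  simp only [h4, Finset.sum_sub_distrib]
  ring

theorem intervalIntegrable_mul_modifiedHurwitzZeta {φ : ℝ → ℂ} (hφ : Continuous φ) {s : ℂ}
    (hs : 0 < s.re) (hs1 : s.re < 1) (hs' : 0 < s.im) :
    IntervalIntegrable (fun α => φ α * modifiedHurwitzZeta s α) MeasureTheory.volume 0 1 ∧
    IntervalIntegrable (fun x : ℝ => φ x * (x : ℂ) ^ (-s)) MeasureTheory.volume 0 1 := by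
  constructor
  · refine (hφ.continuousOn.mul ?_).intervalIntegrable
    rw [Set.uIcc_of_le zero_le_one]
    exact continuousOn_modifiedHurwitzZeta hs hs'
  · exact (intervalIntegral.intervalIntegrable_cpow' (by simpa using hs1)).continuousOn_mul
      hφ.continuousOn

/-- The functional equation for the smoothed sum on the critical line. -/
theorem norm_smoothedZeta_eq {c t : ℝ} (hc : 0 < c) (ht : 0 < t) :
    ‖smoothedZeta c (1 / 2 + t * I)‖
      = ‖(∫ α in (0 : ℝ)..1, ((expKernel c α : ℂ) - 1) * modifiedHurwitzZeta (1 / 2 + t * I) α)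
        + ∫ x in (0 : ℝ)..1, ((expKernel c x : ℂ) - 1) * (x : ℂ) ^ (-(1 / 2 + t * I))‖ := by
  have hre : (1 / 2 + t * I : ℂ).re = 1 / 2 := by simp
  have hre0 : 0 < (1 / 2 + t * I : ℂ).re := by rw [hre]; norm_num
  have hre1 : (1 / 2 + t * I : ℂ).re < 1 := by rw [hre]; norm_num
  have him : 0 < (1 / 2 + t * I : ℂ).im := by simpa using ht
  have hchi := norm_zetaChi_one_half_add t
  have hconj : (starRingEnd ℂ) (-(1 / 2 + t * I)) = (1 / 2 + t * I) - 1 := by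
    simp [Complex.ext_iff]
    norm_num
  set s : ℂ := 1 / 2 + t * I with hs
  have hK : Continuous fun α : ℝ => (expKernel c α : ℂ) - 1 :=
    (continuous_ofReal.comp (continuous_expKernel c)).sub continuous_const
  obtain ⟨k1, k2⟩ := intervalIntegrable_mul_modifiedHurwitzZeta hK hre0 hre1 him
  obtain ⟨o1, o2⟩ := intervalIntegrable_mul_modifiedHurwitzZeta (φ := fun _ => 1)
    continuous_const hre0 hre1 him
  have hH : IntervalIntegrable (fun α : ℝ => modifiedHurwitzZeta s α + (α : ℂ) ^ (-s))
      MeasureTheory.volume 0 1 := by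
    simp only [one_mul] at o1 o2
    exact o1.add o2
  have hv := (summable_nat_add_iff 1).mpr (summable_expKernelCoeff c)
  have key := intervalIntegral.hasSum_integral_of_dominated_convergence
    (μ := MeasureTheory.volume) (a := 0) (b := 1)
    (F := fun (n : ℕ) (α : ℝ) => (expKernelCoeff c (n + 1) : ℂ) *
      (2 * Complex.cos ((2 * Real.pi * (n + 1 : ℕ) * α : ℝ) : ℂ)) *
      (modifiedHurwitzZeta s α + (α : ℂ) ^ (-s)))
    (f := fun α => ((expKernel c α : ℂ) - 1) * (modifiedHurwitzZeta s α + (α : ℂ) ^ (-s)))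
    (fun n α => expKernelCoeff c (n + 1) * (2 * ‖modifiedHurwitzZeta s α + (α : ℂ) ^ (-s)‖))
    (fun n => by
      have := (intervalIntegrable_iff.mp hH).aestronglyMeasurable
      exact (Continuous.aestronglyMeasurable (by fun_prop)).mul this)
    (fun n => Eventually.of_forall fun α _ => by
      rw [norm_mul, norm_mul, norm_mul, norm_real, norm_ofNat, mul_assoc,
        Real.norm_of_nonneg (expKernelCoeff_nonneg _ _)]
      refine mul_le_mul_of_nonneg_left ?_ (expKernelCoeff_nonneg _ _)
      refine mul_le_mul_of_nonneg_right ?_ (norm_nonneg _)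
      exact mul_le_of_le_one_right zero_le_two (norm_cos_ofReal_le _))
    (Eventually.of_forall fun α _ => hv.mul_right _)
    (by
      simp only [tsum_mul_right]
      exact (hH.norm.const_mul 2).const_mul _)
    (Eventually.of_forall fun α hα => by
      rw [Set.uIoc_of_le zero_le_one] at hα
      exact (hasSum_expKernel hc ⟨hα.1.le, hα.2⟩).mul_right _)
  -- Here the critical line enters: `s - 1` is the conjugate of `-s`, so the dual series is the
  -- conjugate of the smoothed sum itself.
  have e1 : ∀ n : ℕ, (∫ α in (0 : ℝ)..1, (expKernelCoeff c (n + 1) : ℂ) *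
      (2 * Complex.cos ((2 * Real.pi * (n + 1 : ℕ) * α : ℝ) : ℂ)) *
      (modifiedHurwitzZeta s α + (α : ℂ) ^ (-s)))
      = zetaChi s * (starRingEnd ℂ)
        (((n + 1 : ℝ) : ℂ) ^ (-s) * (expKernelCoeff c (n + 1) : ℂ)) := by
    intro n
    have hcoe := integral_two_cos_mul_modifiedHurwitzZeta_add hre0 hre1 him (Nat.succ_ne_zero n)
    obtain ⟨c1, c2⟩ := intervalIntegrable_mul_modifiedHurwitzZeta
      (φ := fun α => 2 * Complex.cos ((2 * Real.pi * (n + 1 : ℕ) * α : ℝ) : ℂ)) (by fun_prop)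
      hre0 hre1 him
    simp only [mul_assoc (expKernelCoeff c (n + 1) : ℂ)]
    rw [intervalIntegral.integral_const_mul]
    simp only [mul_add]
    rw [intervalIntegral.integral_add c1 c2, hcoe, map_mul, conj_ofReal]
    have harg : (((n + 1 : ℝ)) : ℂ).arg ≠ Real.pi := by
      rw [arg_ofReal_of_nonneg (by positivity)]
      exact Real.pi_pos.ne
    have : (starRingEnd ℂ) (((n + 1 : ℝ) : ℂ) ^ (-s)) = ((n + 1 : ℕ) : ℂ) ^ (s - 1) := by
      have h := cpow_conj ((n + 1 : ℝ) : ℂ) (-s) harg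
      rw [hconj, conj_ofReal] at h
      rw [← h]
      push_cast
      rfl
    rw [this]
    ring
  simp only [e1] at key
  have h2 := ((hasSum_smoothedZeta c hre0.le).map (starRingEnd ℂ) continuous_conj).mul_left
    (zetaChi s)
  have h3 := h2.unique key
  have h4 := congrArg norm h3
  rw [norm_mul, hchi, one_mul, norm_conj] at h4
  rw [h4]
  simp only [mul_add]
  rw [intervalIntegral.integral_add k1 k2]

/-! ### Upper and lower bounds through the power means. -/

/-- Jensen's inequality for powers, with a continuous probability density on `[0, 1]`. -/
theorem integral_mul_pow_le {w g : ℝ → ℝ} (hw : Continuous w) (hw0 : ∀ x, 0 ≤ w x)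
    (hw1 : ∫ x in (0 : ℝ)..1, w x = 1) (hg : ContinuousOn g (Set.Icc 0 1))
    (hg0 : ∀ x, 0 ≤ g x) (p : ℕ) (hp : p ≠ 0) :
    (∫ x in (0 : ℝ)..1, w x * g x) ^ p ≤ ∫ x in (0 : ℝ)..1, w x * g x ^ p := by
  have hI : Set.uIcc (0 : ℝ) 1 = Set.Icc 0 1 := Set.uIcc_of_le zero_le_one
  set m := ∫ x in (0 : ℝ)..1, w x * g x with hm
  have hm0 : 0 ≤ m := intervalIntegral.integral_nonneg zero_le_one fun x _ =>
    mul_nonneg (hw0 x) (hg0 x)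
  rcases hm0.eq_or_lt with h0 | hpos
  · rw [← h0, zero_pow hp]
    exact intervalIntegral.integral_nonneg zero_le_one fun x _ =>
      mul_nonneg (hw0 x) (pow_nonneg (hg0 x) p)
  have hwg : IntervalIntegrable (fun x => w x * g x) MeasureTheory.volume 0 1 :=
    ContinuousOn.intervalIntegrable (by rw [hI]; exact hw.continuousOn.mul hg)
  have hwp : IntervalIntegrable (fun x => w x * g x ^ p) MeasureTheory.volume 0 1 :=
    ContinuousOn.intervalIntegrable (by rw [hI]; exact hw.continuousOn.mul (hg.pow p))
  have hwi : IntervalIntegrable w MeasureTheory.volume 0 1 := hw.intervalIntegrable _ _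
  -- Bernoulli's inequality at `y / m - 1`: the tangent to `y ^ p` at the mean `m` lies below the
  -- curve, and its weighted integral is `m ^ p`.
  have tangent : ∀ y : ℝ, 0 ≤ y → m ^ p * (1 - p) + m ^ p * (p / m) * y ≤ y ^ p := by
    intro y hy
    have h := one_add_mul_le_pow (a := y / m - 1)
      (by have : 0 ≤ y / m := div_nonneg hy hm0; linarith) p
    rw [add_sub_cancel, div_pow, le_div_iff₀ (by positivity)] at h
    refine le_of_eq_of_le ?_ h
    field_simp
    ring
  have hle : ∫ x in (0 : ℝ)..1, (m ^ p * (1 - p) * w x + m ^ p * (p / m) * (w x * g x))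
      ≤ ∫ x in (0 : ℝ)..1, w x * g x ^ p := by
    refine intervalIntegral.integral_mono_on zero_le_one
      ((hwi.const_mul _).add (hwg.const_mul _)) hwp fun x _ => ?_
    have := mul_le_mul_of_nonneg_left (tangent (g x) (hg0 x)) (hw0 x)
    linarith
  rw [intervalIntegral.integral_add (hwi.const_mul _) (hwg.const_mul _),
    intervalIntegral.integral_const_mul, intervalIntegral.integral_const_mul, hw1, ← hm] at hle
  refine le_of_eq_of_le ?_ hle
  field_simp
  ring

/-- The kernel average of `ζ₁` is controlled by the power mean. -/
theorem integral_mul_norm_le_rpow_hurwitzPowerMean {w : ℝ → ℝ} {B : ℝ} (hw : Continuous w)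
    (hw0 : ∀ x, 0 ≤ w x) (hw1 : ∫ x in (0 : ℝ)..1, w x = 1)
    (hB : ∀ x ∈ Set.Icc (0 : ℝ) 1, w x ≤ B) {t : ℝ} (ht : 0 < t) {k : ℕ} (hk : 1 ≤ k) :
    ∫ α in (0 : ℝ)..1, w α * ‖modifiedHurwitzZeta (1 / 2 + t * I) α‖
      ≤ (B * hurwitzPowerMean k t) ^ (1 / (2 * (k : ℝ))) := by
  have hf : ContinuousOn (fun α => ‖modifiedHurwitzZeta (1 / 2 + t * I) α‖) (Set.Icc 0 1) :=
    (continuousOn_modifiedHurwitzZeta (by simp) (by simpa using ht)).norm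
  have hI : Set.uIcc (0 : ℝ) 1 = Set.Icc 0 1 := Set.uIcc_of_le zero_le_one
  have h1 := integral_mul_pow_le hw hw0 hw1 hf (fun _ => norm_nonneg _) (2 * k) (by omega)
  have h2 : ∫ α in (0 : ℝ)..1, w α * ‖modifiedHurwitzZeta (1 / 2 + t * I) α‖ ^ (2 * k)
      ≤ B * hurwitzPowerMean k t := by
    rw [hurwitzPowerMean, ← intervalIntegral.integral_const_mul]
    refine intervalIntegral.integral_mono_on zero_le_one
      (ContinuousOn.intervalIntegrable (by rw [hI]; exact hw.continuousOn.mul (hf.pow _)))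
      (ContinuousOn.intervalIntegrable (by rw [hI]; exact continuousOn_const.mul (hf.pow _)))
      fun x hx => mul_le_mul_of_nonneg_right (hB x hx) (by positivity)
  have h0 : 0 ≤ ∫ α in (0 : ℝ)..1, w α * ‖modifiedHurwitzZeta (1 / 2 + t * I) α‖ :=
    intervalIntegral.integral_nonneg zero_le_one fun x _ => mul_nonneg (hw0 x) (norm_nonneg _)
  have h3 := Real.rpow_le_rpow (by positivity) (h1.trans h2)
    (by positivity : 0 ≤ 1 / (2 * (k : ℝ)))
  refine le_of_eq_of_le ?_ h3
  have := Real.pow_rpow_inv_natCast h0 (show 2 * k ≠ 0 by omega)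
  rw [one_div (2 * (k : ℝ))]
  push_cast at this
  exact this.symm

theorem hurwitzPowerMean_nonneg (k : ℕ) (t : ℝ) : 0 ≤ hurwitzPowerMean k t :=
  intervalIntegral.integral_nonneg zero_le_one fun _ _ => by positivity

theorem le_norm_one_sub {t : ℝ} : |t| ≤ ‖1 - (1 / 2 + t * I : ℂ)‖ := by
  refine le_trans (le_of_eq ?_) (abs_im_le_norm _)
  simp

/-- The power means of `ζ₁` are bounded below: its first Fourier coefficient has size about `1`. -/
theorem one_le_four_mul_rpow_hurwitzPowerMean {t : ℝ} (ht : 40 ≤ t) {k : ℕ} (hk : 1 ≤ k) :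
    1 ≤ 4 * hurwitzPowerMean k t ^ (1 / (2 * (k : ℝ))) := by
  have ht0 : 0 < t := by linarith
  have hre : (1 / 2 + t * I : ℂ).re = 1 / 2 := by simp
  have hre0 : 0 < (1 / 2 + t * I : ℂ).re := by rw [hre]; norm_num
  have hre1 : (1 / 2 + t * I : ℂ).re < 1 := by rw [hre]; norm_num
  have him : 0 < (1 / 2 + t * I : ℂ).im := by simpa using ht0
  have h1 := integral_mul_norm_le_rpow_hurwitzPowerMean (w := fun _ => 1) (B := 1)
    continuous_const (fun _ => zero_le_one) (by simp) (fun _ _ => le_rfl) ht0 hk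
  simp only [one_mul] at h1
  have h2 := integral_two_cos_mul_modifiedHurwitzZeta_add hre0 hre1 him one_ne_zero
  have hn := congrArg norm h2
  rw [norm_mul, norm_zetaChi_one_half_add, Nat.cast_one, Nat.cast_one, one_cpow, norm_one] at hn
  -- Integration by parts gives at most `(2 + 16) / t`, using `4π < 16`; this is below `1/2` for `t
  -- ≥ 40`.
  have h3 : ‖∫ x in (0 : ℝ)..1, 2 * Complex.cos ((2 * Real.pi * 1 * x : ℝ) : ℂ) *
      (x : ℂ) ^ (-(1 / 2 + t * I : ℂ))‖ ≤ 1 / 2 := by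
    have hd : ∀ x : ℝ, HasDerivAt (fun x : ℝ => 2 * Complex.cos ((2 * Real.pi * 1 * x : ℝ) : ℂ))
        (2 * (-Complex.sin ((2 * Real.pi * 1 * x : ℝ) : ℂ) * (2 * Real.pi * 1 : ℝ))) x := by
      intro x
      have h := ((hasDerivAt_const_mul ((2 * Real.pi * 1 : ℝ) : ℂ) (x := (x : ℂ))).ccos.const_mul
        2).comp_ofReal
      simpa only [ofReal_mul] using h
    have hpi := Real.pi_lt_four
    have hpi0 := Real.pi_pos
    refine (norm_integral_mul_cpow_neg_le hre1 hd (by fun_prop) (B := 16)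
      (fun x _ => ?_)).trans ?_
    · rw [norm_mul, norm_mul, norm_neg, norm_real, norm_ofNat, Real.norm_of_nonneg (by positivity)]
      nlinarith [norm_sin_ofReal_le (2 * Real.pi * 1 * x), norm_nonneg
        (Complex.sin ((2 * Real.pi * 1 * x : ℝ) : ℂ))]
    · have hb := le_norm_one_sub (t := t)
      rw [abs_of_pos ht0] at hb
      rw [div_le_div_iff₀ (by linarith) two_pos, norm_mul, norm_ofNat]
      have := norm_cos_ofReal_le (2 * Real.pi * 1 * 1)
      linarith
  have h4 : ‖∫ α in (0 : ℝ)..1, 2 * Complex.cos ((2 * Real.pi * 1 * α : ℝ) : ℂ) *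
      modifiedHurwitzZeta (1 / 2 + t * I) α‖
      ≤ 2 * ∫ α in (0 : ℝ)..1, ‖modifiedHurwitzZeta (1 / 2 + t * I) α‖ := by
    rw [← intervalIntegral.integral_const_mul]
    refine intervalIntegral.norm_integral_le_of_norm_le zero_le_one
      (Eventually.of_forall fun α _ => ?_) ?_
    · rw [norm_mul, norm_mul, norm_ofNat]
      gcongr
      exact mul_le_of_le_one_right zero_le_two (norm_cos_ofReal_le _)
    · refine ContinuousOn.intervalIntegrable ?_
      rw [Set.uIcc_of_le zero_le_one]
      exact continuousOn_const.mul (continuousOn_modifiedHurwitzZeta hre0 him).norm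
  have h5 := norm_add_le (∫ α in (0 : ℝ)..1, 2 * Complex.cos ((2 * Real.pi * 1 * α : ℝ) : ℂ) *
      modifiedHurwitzZeta (1 / 2 + t * I) α) (∫ x in (0 : ℝ)..1,
      2 * Complex.cos ((2 * Real.pi * 1 * x : ℝ) : ℂ) * (x : ℂ) ^ (-(1 / 2 + t * I : ℂ)))
  rw [hn] at h5
  linarith

/-! ### The pointwise bound for `ζ` and the Lindelöf hypothesis. -/

/-- `ζ` on the critical line in terms of one kernel average of `ζ₁`, which has width `t ^ (-1/2)`. -/
theorem norm_riemannZeta_le {c t : ℝ} (ht : 1 ≤ t) (hc2 : 2 ≤ c) (hc : c ^ 2 = 2 * Real.pi * t) :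
    ‖riemannZeta (1 / 2 + t * I)‖
      ≤ 2 * ‖∫ α in (0 : ℝ)..1, (expKernel c α : ℂ) * modifiedHurwitzZeta (1 / 2 + t * I) α‖ + 40 := by
  have ht0 : 0 < t := by linarith
  have hc0 : 0 < c := by linarith
  have hre : (1 / 2 + t * I : ℂ).re = 1 / 2 := by simp
  have hre0 : 0 < (1 / 2 + t * I : ℂ).re := by rw [hre]; norm_num
  have hre1 : (1 / 2 + t * I : ℂ).re < 1 := by rw [hre]; norm_num
  have him : 0 < (1 / 2 + t * I : ℂ).im := by simpa using ht0
  have h1 := norm_integral_expKernel_mul_sub_le ht hc2 hc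
  have h2 := norm_smoothedZeta_eq hc0 ht0
  have hb := le_norm_one_sub (t := t)
  rw [abs_of_pos ht0] at hb
  have hint := integral_modifiedHurwitzZeta hre0 him
  set s : ℂ := 1 / 2 + t * I with hs
  have hK : Continuous fun α : ℝ => (expKernel c α : ℂ) :=
    continuous_ofReal.comp (continuous_expKernel c)
  have e1 : ∫ α in (0 : ℝ)..1, ((expKernel c α : ℂ) - 1) * modifiedHurwitzZeta s α
      = (∫ α in (0 : ℝ)..1, (expKernel c α : ℂ) * modifiedHurwitzZeta s α) + 1 / (1 - s) := by
    have i1 := (intervalIntegrable_mul_modifiedHurwitzZeta hK hre0 hre1 him).1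
    have i2 := (intervalIntegrable_mul_modifiedHurwitzZeta (φ := fun _ => 1)
      continuous_const hre0 hre1 him).1
    simp only [one_mul] at i2
    simp only [sub_mul, one_mul]
    rw [intervalIntegral.integral_sub i1 i2, hint, sub_neg_eq_add]
  have e2 : ‖1 / (1 - s)‖ ≤ 1 := by
    rw [norm_div, norm_one, div_le_one (by linarith)]
    linarith
  -- The kernel's derivative is at most `c ^ 2 / 2 = πt`, and integration by parts divides by at
  -- least `t`: a kernel of width `t ^ (-1/2)` still gives `O(1)`.
  have e3 : ‖∫ x in (0 : ℝ)..1, ((expKernel c x : ℂ) - 1) * (x : ℂ) ^ (-s)‖ ≤ 16 := by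
    have hpi := Real.pi_lt_four
    refine (norm_integral_mul_cpow_neg_le hre1
      (fun x => (hasDerivAt_expKernel c x).ofReal_comp.sub_const 1)
      (continuous_ofReal.comp (continuous_expKernelDeriv c)) (B := c ^ 2 / 2)
      (fun x hx => ?_)).trans ?_
    · rw [norm_real]
      exact abs_expKernelDeriv_le hc0 hx
    · have hk : ‖(expKernel c 1 : ℂ) - 1‖ ≤ c + 1 := by
        refine (norm_sub_le _ _).trans ?_
        rw [norm_real, Real.norm_of_nonneg (expKernel_nonneg hc0 1), norm_one]
        linarith [expKernel_le hc2 (α := 1) (by simp)]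
      rw [div_le_iff₀ (by linarith)]
      nlinarith
  rw [e1] at h2
  have h3 := norm_add_le ((∫ α in (0 : ℝ)..1, (expKernel c α : ℂ) * modifiedHurwitzZeta s α)
    + 1 / (1 - s)) (∫ x in (0 : ℝ)..1, ((expKernel c x : ℂ) - 1) * (x : ℂ) ^ (-s))
  have h4 := norm_add_le (∫ α in (0 : ℝ)..1, (expKernel c α : ℂ) * modifiedHurwitzZeta s α)
    (1 / (1 - s))
  rw [← h2] at h3
  have h5 : ‖riemannZeta s‖ ≤ ‖(∫ α in (0 : ℝ)..1, (expKernel c α : ℂ) * modifiedHurwitzZeta s α)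
      - (riemannZeta s - smoothedZeta c s)‖
      + ‖∫ α in (0 : ℝ)..1, (expKernel c α : ℂ) * modifiedHurwitzZeta s α‖
      + ‖smoothedZeta c s‖ := by
    generalize (∫ α in (0 : ℝ)..1, (expKernel c α : ℂ) * modifiedHurwitzZeta s α) = J
    calc ‖riemannZeta s‖ = ‖-(J - (riemannZeta s - smoothedZeta c s)) + J + smoothedZeta c s‖ := by
          congr 1; ring
      _ ≤ _ := by
          refine (norm_add₃_le).trans_eq ?_
          rw [norm_neg]
  -- The errors `20`, `1` and `16` add up to `37`.
  linarith

theorem norm_riemannZeta_le_rpow_hurwitzPowerMean {t : ℝ} (ht : 40 ≤ t) {k : ℕ} (hk : 1 ≤ k) :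
    ‖riemannZeta (1 / 2 + t * I)‖
      ≤ 200 * t ^ (1 / (4 * (k : ℝ))) * hurwitzPowerMean k t ^ (1 / (2 * (k : ℝ))) := by
  have ht0 : 0 < t := by linarith
  have hpi := Real.pi_gt_three
  have hpi4 := Real.pi_lt_four
  set c : ℝ := Real.sqrt (2 * Real.pi * t) with hcd
  have hc : c ^ 2 = 2 * Real.pi * t := Real.sq_sqrt (by positivity)
  have hc2 : 2 ≤ c := Real.le_sqrt_of_sq_le (by nlinarith)
  have hc0 : 0 < c := by linarith
  have hk0 : (0 : ℝ) < k := by exact_mod_cast hk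
  have hk1 : (1 : ℝ) ≤ k := by exact_mod_cast hk
  have h1 := norm_riemannZeta_le (by linarith) hc2 hc
  have h2 := integral_mul_norm_le_rpow_hurwitzPowerMean (continuous_expKernel c)
    (expKernel_nonneg hc0) (integral_expKernel_real hc0) (fun x hx => expKernel_le hc2 hx) ht0 hk
  have h3 : ‖∫ α in (0 : ℝ)..1, (expKernel c α : ℂ) * modifiedHurwitzZeta (1 / 2 + t * I) α‖
      ≤ ∫ α in (0 : ℝ)..1, expKernel c α * ‖modifiedHurwitzZeta (1 / 2 + t * I) α‖ := by
    refine (intervalIntegral.norm_integral_le_integral_norm zero_le_one).trans_eq ?_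
    congr 1
    ext α
    rw [norm_mul, norm_real, Real.norm_of_nonneg (expKernel_nonneg hc0 α)]
  rw [Real.mul_rpow hc0.le (hurwitzPowerMean_nonneg k t)] at h2
  set e : ℝ := 1 / (2 * (k : ℝ)) with he
  have he0 : 0 ≤ e := by positivity
  have he1 : e ≤ 1 := by
    rw [he, div_le_one (by positivity)]
    linarith
  have h4 : c ^ e ≤ 3 * t ^ (1 / (4 * (k : ℝ))) := by
    have hs : c ≤ 3 * t ^ (1 / 2 : ℝ) := by
      rw [← Real.sqrt_eq_rpow, hcd, Real.sqrt_le_iff, mul_pow, Real.sq_sqrt ht0.le]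
      refine ⟨by positivity, ?_⟩
      nlinarith [Real.pi_lt_d2]
    calc c ^ e ≤ (3 * t ^ (1 / 2 : ℝ)) ^ e := Real.rpow_le_rpow hc0.le hs he0
      _ = 3 ^ e * t ^ (1 / (4 * (k : ℝ))) := by
          rw [Real.mul_rpow (by norm_num) (by positivity), ← Real.rpow_mul ht0.le]
          congr 2
          rw [he]
          field_simp
          norm_num
      _ ≤ 3 ^ (1 : ℝ) * t ^ (1 / (4 * (k : ℝ))) := by
          gcongr
          norm_num
      _ = _ := by rw [Real.rpow_one]
  have h5 := one_le_four_mul_rpow_hurwitzPowerMean ht hk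
  rw [← he] at h5
  have h6 : 1 ≤ t ^ (1 / (4 * (k : ℝ))) := Real.one_le_rpow (by linarith) (by positivity)
  have h7 : 0 ≤ hurwitzPowerMean k t ^ e := Real.rpow_nonneg (hurwitzPowerMean_nonneg k t) _
  set P := hurwitzPowerMean k t ^ e
  set Q := t ^ (1 / (4 * (k : ℝ)))
  have h8 : c ^ e * P ≤ 3 * Q * P := mul_le_mul_of_nonneg_right h4 h7
  have h9 : P ≤ Q * P := le_mul_of_one_le_left h7 h6
  -- The additive `40` becomes `160 P` because `1 ≤ 4 P`.
  calc ‖riemannZeta (1 / 2 + t * I)‖ ≤ 2 * (3 * Q * P) + 160 * P := by linarith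
    _ ≤ 200 * Q * P := by nlinarith

theorem lindelofHypothesis_of_hurwitzPowerMean
    (h : ∀ ε : ℝ, 0 < ε → ∀ k : ℕ, 1 ≤ k → hurwitzPowerMean k =O[atTop] (fun t : ℝ => t ^ ε)) :
    LindelofHypothesis := by
  intro ε hε
  -- With `k > 1/ε`, the factor `t ^ (1/(4k))` costs at most `t ^ (ε/2)`. The hypothesis with the
  -- same `ε` suffices, since `I_k ^ (1/(2k))` then contributes `t ^ (ε/(2k)) ≤ t ^ (ε/2)`.
  obtain ⟨n, hn⟩ := exists_nat_gt (1 / ε)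
  set k : ℕ := n + 1 with hk
  have hk1 : (1 : ℝ) ≤ k := by rw [hk]; push_cast; linarith [(Nat.cast_nonneg n : (0 : ℝ) ≤ n)]
  have hk0 : (0 : ℝ) < k := by linarith
  have hkε : 1 / (4 * (k : ℝ)) ≤ ε / 2 := by
    have : 1 / ε < k := by rw [hk]; push_cast; linarith
    rw [div_lt_iff₀ hε] at this
    rw [div_le_div_iff₀ (by positivity) two_pos]
    nlinarith
  obtain ⟨B, hB0, hB⟩ := (h ε hε k (by omega)).exists_nonneg
  refine IsBigO.of_bound (200 * B ^ (1 / (2 * (k : ℝ)))) ?_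
  filter_upwards [hB.bound, eventually_ge_atTop 40] with t hBt ht
  have ht0 : 0 < t := by linarith
  have hI := hurwitzPowerMean_nonneg k t
  rw [Real.norm_of_nonneg hI, Real.norm_of_nonneg (by positivity)] at hBt
  rw [Real.norm_of_nonneg (by positivity : 0 ≤ t ^ ε)]
  have h1 : hurwitzPowerMean k t ^ (1 / (2 * (k : ℝ)))
      ≤ B ^ (1 / (2 * (k : ℝ))) * t ^ (ε / 2) := by
    refine (Real.rpow_le_rpow hI hBt (by positivity)).trans ?_
    rw [Real.mul_rpow hB0 (by positivity), ← Real.rpow_mul ht0.le]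
    refine mul_le_mul_of_nonneg_left (Real.rpow_le_rpow_of_exponent_le (by linarith) ?_)
      (by positivity)
    rw [mul_one_div]
    exact div_le_div_of_nonneg_left hε.le two_pos (by linarith)
  calc ‖riemannZeta (1 / 2 + t * I)‖
      ≤ 200 * t ^ (1 / (4 * (k : ℝ))) * hurwitzPowerMean k t ^ (1 / (2 * (k : ℝ))) :=
        norm_riemannZeta_le_rpow_hurwitzPowerMean ht (by omega)
    _ ≤ 200 * t ^ (ε / 2) * (B ^ (1 / (2 * (k : ℝ))) * t ^ (ε / 2)) := by
        refine mul_le_mul ?_ h1 (Real.rpow_nonneg hI _) (by positivity)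
        exact mul_le_mul_of_nonneg_left (Real.rpow_le_rpow_of_exponent_le (by linarith) hkε)
          (by norm_num)
    _ = 200 * B ^ (1 / (2 * (k : ℝ))) * (t ^ (ε / 2) * t ^ (ε / 2)) := by ring
    _ = 200 * B ^ (1 / (2 * (k : ℝ))) * t ^ ε := by
        rw [← Real.rpow_add ht0, add_halves]

theorem theorem1 :
    (∃ C : ℝ, 0 < C ∧ ∃ T : ℝ, 0 < T ∧ ∀ t : ℝ, T ≤ t → ∀ k : ℕ, 1 ≤ k →
      ‖riemannZeta (1 / 2 + (t : ℂ) * I)‖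
        ≤ C * t ^ (1 / (4 * (k : ℝ))) * hurwitzPowerMean k t ^ (1 / (2 * (k : ℝ))))
    ∧ ((∀ ε : ℝ, 0 < ε → ∀ k : ℕ, 1 ≤ k →
          hurwitzPowerMean k =O[atTop] (fun t : ℝ => t ^ ε))
        → LindelofHypothesis) :=
  ⟨⟨200, by norm_num, 40, by norm_num, fun _ ht _ hk =>
    norm_riemannZeta_le_rpow_hurwitzPowerMean ht hk⟩, lindelofHypothesis_of_hurwitzPowerMean⟩
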